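/- **Setting.** Fix a commutative ring $R$ and an integer $n\ge 0$. Manifolds are compact piecewise linear manifolds, possibly with boundary. *Fields.* Let $\mathcal F$ be an $n$-dimensional system of fields enriched over $R$-modules. That is, for $k\le n$ there are functors $\mathcal F_k$ from $k$-manifolds and PL homeomorphisms to sets, with natural boundary restrictions $\mathcal F_k(X)\to\mathcal F_{k-1}(\partial X)$; for an $n$-manifold $X$ and $c\in\mathcal F_{n-1}(\partial X)$ the set $\mathcal F(X;c)$ of fields restricting to $c$ is an $R$-module, functorially (for $n=0$ there is just one boundary condition). Disjoint union of fields is unital, commutative, associative, natural and compatible with boundaries; it is a bijection $\mathcal F_k(X_1)\times\mathcal F_k(X_2)\cong\mathcal F_k(X_1\sqcup X_2)$ for $k<n$, and for $k=n$ it induces isomorphisms $\mathcal F(X_1;c_1)\otimes_R\mathcal F(X_2;c_2)\cong\mathcal F(X_1\sqcup X_2;c_1\sqcup c_2)$. If $X'$ is obtained from $X$ by gluing together two disjoint codimension-zero submanifolds $Y,Y'$ of $\partial X$ (corners allowed), then fields on $X$ whose boundary restriction splits along $\partial Y\sqcup\partial Y'$ and agrees on $Y$ and $Y'$ can be glued to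 give fields on $X'$; gluing is injective (for $k=n$: on fields with a fixed boundary condition), natural, compatible with disjoint unions and with boundaries, strictly associative, and $R$-linear for $k=n$. *Local relations.* Let $U$ be a system of local relations: submodules $U(B;c)\subseteq\mathcal F(B;c)$ for all $n$-balls $B$, preserved by homeomorphisms, and forming an ideal: if a ball $B$ is obtained by gluing together a ball $B'$ and a manifold $B''$, then gluing $u\in U(B')$ to a field $r$ on $B''$ gives an element $u\bullet r\in U(B)$ whenever the gluing is defined. For an $n$-manifold $X$ put $A(X;c)=\mathcal F(X;c)/U(X;c)$, where $U(X;c)$ is spanned by the fields $u\bullet r$ with $u$ a local relation on an embedded ball $B\subseteq X$ and $r$ a field on $X\setminus B$. *The blob complex.* A gluing decomposition of $X$ is a finite sequence of gluings $M_0\to M_1\to\dots\to M_m=X$. A $k$-blob diagram on $X$ with boundary condition $c$ consists of subsets $B_1,\dots,B_k\subseteq X$ and a field $r\in\mathcal F(X;c)$ for which there is a gluing decomposition of $X$ such that: $r$ is glued from a product of fields on the components of $M_0$; each $B_i$ is the image in $X$ of a connected component of some $M_l$, and this component is a ball; and if $B_i$ is a twig blob (no $B_j$ is strictly contained in it), then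 the restriction of $r$ to that component is a local relation. The module $\mathcal B_k(X;c)$ is the direct sum, over ordered configurations $(B_1,\dots,B_k)$, of the submodules of $\mathcal F(X;c)$ spanned by the $r$ for which $(B_1,\dots,B_k;r)$ is a blob diagram, modulo the identification of reordered configurations up to the sign of the permutation. The differential is $\partial(B_1,\dots,B_k;r)=\sum_{i=1}^k(-1)^{i-1}(B_1,\dots,\widehat{B_i},\dots,B_k;r)$. **Proposition (contractibility on balls).** Let $B^n$ be an $n$-ball, $c$ a boundary condition on $\partial B^n$, and $H_0=H_0(\mathcal B_*(B^n;c))$. Let $p$ denote both the quotient map $\mathcal B_0(B^n;c)\to H_0$ and the chain map $\mathcal B_*(B^n;c)\to H_0$ onto $H_0$ regarded as a complex concentrated in degree $0$. 1. Suppose $s\colon H_0\to\mathcal B_0(B^n;c)$ is an $R$-linear splitting, $p\circ s=\mathrm{id}$. Then $p$ is a chain homotopy equivalence, with homotopy inverse the chain map $s$. Moreover there is a homotopy $h$ from $s\circ p$ to the identity, $\partial h+h\partial=\mathrm{id}-s\circ p$, which adds the whole ball as an outermost blob: $$h_0(x)=(B^n;\,x-s(p(x))),\qquad h_k(B_1,\dots,B_k;r)=(-1)^k(B_1,\dots,B_k,B^n;r)\quad(k\ge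 1);$$ in particular the configurations on the right, with the given labels, lie in the modules of blob diagrams. 2. If $R$ is a field, then such a splitting $s$ exists. 3. Every field in $\mathcal F(B^n;c)$ is a $0$-blob diagram, and there is an $R$-linear isomorphism $H_0\cong A(B^n;c)$ that sends $p(x)$ to the class of $x$ for every $x\in\mathcal F(B^n;c)=\mathcal B_0(B^n;c)$. -/

import Mathlib

open Topology

universe u v

namespace BlobComplex

noncomputable section

/-! ### Compact piecewise linear manifolds -/

/-- The ambient space of all polyhedra: sequences of reals. Every compact polyhedron in some `ℝ^N`
is a polyhedron here, and every compact polyhedron here lies in a finite dimensional affine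
subspace. -/
abbrev Pt : Type := ℕ → ℝ

/-- A compact polyhedron: a finite union of convex hulls of finite sets. -/
def IsPolyhedron (X : Set Pt) : Prop :=
  ∃ T : Finset (Finset Pt), X = ⋃ s ∈ T, convexHull ℝ (s : Set Pt)

/-- A piecewise linear map between compact polyhedra: it is continuous, and affine on each of
finitely many compact convex polyhedra whose union is the domain. -/
def IsPL {X Y : Set Pt} (f : X → Y) : Prop :=
  Continuous f ∧ ∃ T : Finset (Finset Pt), X = ⋃ s ∈ T, convexHull ℝ (s : Set Pt) ∧
    ∀ s ∈ T, ∃ A : Pt →ᵃ[ℝ] Pt, ∀ x : X, x.1 ∈ convexHull ℝ (s : Set Pt) → (f x).1 = A x.1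

/-- A piecewise linear homeomorphism. -/
structure PLEquiv (X Y : Set Pt) extends X ≃ Y where
  pl : IsPL toFun
  pl_symm : IsPL invFun

instance (X Y : Set Pt) : CoeFun (PLEquiv X Y) fun _ => X → Y := ⟨fun f => f.toEquiv⟩

/-- The standard `k`-ball `[0,1]^k`. -/
def cube (k : ℕ) : Set Pt := {x | (∀ i < k, 0 ≤ x i ∧ x i ≤ 1) ∧ ∀ i, k ≤ i → x i = 0}

/-- The interior `(0,1)^k` of the standard `k`-ball. -/
def openCube (k : ℕ) : Set Pt := {x | (∀ i < k, 0 < x i ∧ x i < 1) ∧ ∀ i, k ≤ i → x i = 0}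

/-- `x` has a neighbourhood in `X` that is a PL `k`-ball. -/
def HasChart (k : ℕ) (X : Set Pt) (x : Pt) : Prop :=
  ∃ N ⊆ X, N ∈ 𝓝[X] x ∧ Nonempty (PLEquiv N (cube k))

/-- `x` has a neighbourhood in `X` that is a PL `k`-ball with `x` in its interior. -/
def IsInteriorPt (k : ℕ) (X : Set Pt) (x : Pt) : Prop :=
  ∃ N ⊆ X, N ∈ 𝓝[X] x ∧ ∃ (f : PLEquiv N (cube k)) (hx : x ∈ N), (f ⟨x, hx⟩).1 ∈ openCube k

/-- The boundary points of a `k`-manifold. -/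
def bdrySet (k : ℕ) (X : Set Pt) : Set Pt := {x ∈ X | ¬ IsInteriorPt k X x}

/-- Compact PL `k`-manifolds, possibly with boundary (and possibly empty): compact polyhedra in
which every point has a neighbourhood that is a PL `k`-ball. That the boundary of a `(k+1)`-manifold
is a `k`-manifold follows from the local condition; it is recorded so that the boundary is available
as an object. -/
def IsPLMfd : ℕ → Set Pt → Prop
  | 0, X => IsPolyhedron X ∧ ∀ x ∈ X, HasChart 0 X x
  | k + 1, X => IsPolyhedron X ∧ (∀ x ∈ X, HasChart (k + 1) X x) ∧ IsPLMfd k (bdrySet (k + 1) X)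

/-- Compact PL `k`-manifolds; the morphisms between them are the `PLEquiv`s. -/
@[ext]
structure PLMan (k : ℕ) where
  carrier : Set Pt
  isMfd : IsPLMfd k carrier

namespace PLMan

/-- The boundary. -/
def bdry {k : ℕ} (X : PLMan (k + 1)) : PLMan k := ⟨bdrySet (k + 1) X.carrier, X.isMfd.2.2⟩

/-- `X` is an `n`-ball. -/
def IsBall {k : ℕ} (X : PLMan k) : Prop := Nonempty (PLEquiv X.carrier (cube k))

/-- `X` is the disjoint union of `X₁` and `X₂`. -/
def IsDisjUnion {k : ℕ} (X X₁ X₂ : PLMan k) : Prop :=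
  Disjoint X₁.carrier X₂.carrier ∧ X.carrier = X₁.carrier ∪ X₂.carrier

/-- `P` is a union of connected components of `M`. -/
def IsPart {k : ℕ} (P M : PLMan k) : Prop := ∃ Q, IsDisjUnion M P Q

end PLMan

open PLMan

/-! ### Gluing manifolds -/

/-- `X'` is obtained from the `(k+1)`-manifold `X` by gluing together the disjoint codimension-zero
submanifolds `Y` and `Y'` of its boundary along `φ`. The rest of the boundary is `W`, and corners
(`∂Y ⊔ ∂Y' = ∂W` nonempty) are allowed. -/
structure Gluing {k : ℕ} (X X' : PLMan (k + 1)) where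
  Y : PLMan k
  Y' : PLMan k
  V : PLMan k
  W : PLMan k
  V_eq : IsDisjUnion V Y Y'
  φ : PLEquiv Y.carrier Y'.carrier
  cover : V.carrier ∪ W.carrier = X.bdry.carrier
  corner : V.carrier ∩ W.carrier = bdrySet k V.carrier
  corner' : V.carrier ∩ W.carrier = bdrySet k W.carrier
  /-- The quotient map. -/
  q : X.carrier → X'.carrier
  q_pl : IsPL q
  q_surj : Function.Surjective q
  q_eq : ∀ x x', q x = q x' ↔ x = x' ∨
    ∃ y : Y.carrier, (x.1 = y.1 ∧ x'.1 = (φ y).1) ∨ (x'.1 = y.1 ∧ x.1 = (φ y).1)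

/-- One gluing of `k`-manifolds; there are none for `k = 0`. -/
def GlueStep : (k : ℕ) → PLMan k → PLMan k → Type
  | 0, _, _ => Empty
  | _ + 1, X, X' => Gluing X X'

namespace GlueStep

/-- The quotient map. -/
def q : {k : ℕ} → {X X' : PLMan k} → GlueStep k X X' → X.carrier → X'.carrier
  | 0, _, _, g => nomatch g
  | _ + 1, _, _, g => Gluing.q g

/-- The first copy of the seam. -/
def left : {k : ℕ} → {X X' : PLMan k} → GlueStep k X X' → Set Pt
  | 0, _, _, _ => ∅
  | _ + 1, _, _, g => (Gluing.Y g).carrier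

/-- The second copy of the seam. -/
def right : {k : ℕ} → {X X' : PLMan k} → GlueStep k X X' → Set Pt
  | 0, _, _, _ => ∅
  | _ + 1, _, _, g => (Gluing.Y' g).carrier

end GlueStep

/-- A finite sequence of gluings, followed by a homeomorphism. -/
inductive GlueSeq {k : ℕ} : PLMan k → PLMan k → Type
  | iso {X Z : PLMan k} (f : PLEquiv X.carrier Z.carrier) : GlueSeq X Z
  | cons {X X' Z : PLMan k} (g : GlueStep k X X') (s : GlueSeq X' Z) : GlueSeq X Z

/-- The total quotient map of a sequence of gluings. -/
def GlueSeq.map {k : ℕ} {X Z : PLMan k} : GlueSeq X Z → X.carrier → Z.carrier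
  | .iso f => f
  | .cons g s => s.map ∘ g.q

/-! ### Systems of fields -/

/-- The data of a system of fields (without product fields). Dimensions above the dimension of the
system play no role. -/
structure FieldData where
  /-- The fields on a manifold. -/
  C : (k : ℕ) → PLMan k → Type v
  /-- The action of homeomorphisms. -/
  map : {k : ℕ} → {X X' : PLMan k} → PLEquiv X.carrier X'.carrier → C k X → C k X'
  /-- Restriction to the boundary. -/
  bd : {k : ℕ} → {X : PLMan (k + 1)} → C (k + 1) X → C k X.bdry
  /-- The disjoint union of two fields. -/
  du : {k : ℕ} → {X X₁ X₂ : PLMan k} → IsDisjUnion X X₁ X₂ → C k X₁ → C k X₂ → C k X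
  /-- The field on the empty manifold that is the unit for disjoint union. -/
  empty : {k : ℕ} → {X : PLMan k} → X.carrier = ∅ → C k X
  /-- `Glues g a b`: the field `a` can be glued along `g`, and the result is `b`. -/
  Glues : {k : ℕ} → {X X' : PLMan k} → GlueStep k X X' → C k X → C k X' → Prop

namespace FieldData

variable (F : FieldData.{v})

/-- `b` is the result of gluing the field `a` along a sequence of gluings. -/
def SeqGlues {k : ℕ} {X Z : PLMan k} : GlueSeq X Z → F.C k X → F.C k Z → Prop
  | .iso f, a, b => b = F.map f a
  | .cons g s, a, b => ∃ a', F.Glues g a a' ∧ SeqGlues s a' b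

/-- `Z` is the union of `V` and `W` along a part of their boundaries, and the field `c` on `Z` is
the result of gluing the fields `v` on `V` and `w` on `W`. (In dimension zero the union is disjoint.
Since `V` and `W` may meet, disjoint copies of them are glued.) -/
def IsUnion {k : ℕ} {Z V W : PLMan k} (c : F.C k Z) (v : F.C k V) (w : F.C k W) : Prop :=
  ∃ (D D₁ D₂ : PLMan k) (h : IsDisjUnion D D₁ D₂) (f₁ : PLEquiv V.carrier D₁.carrier)
    (f₂ : PLEquiv W.carrier D₂.carrier) (s : GlueSeq D Z),
    (∀ (x : D.carrier) (y : V.carrier), x.1 = (f₁ y).1 → (s.map x).1 = y.1) ∧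
    (∀ (x : D.carrier) (y : W.carrier), x.1 = (f₂ y).1 → (s.map x).1 = y.1) ∧
    F.SeqGlues s (F.du h (F.map f₁ v) (F.map f₂ w)) c

/-- The boundary of the field `a` splits into fields on the two copies of the seam and on the rest
of the boundary, and the fields on the two copies agree. -/
def Gluable : {k : ℕ} → {X X' : PLMan k} → GlueStep k X X' → F.C k X → Prop
  | 0, _, _, _, _ => False
  | k + 1, _, _, g, a => ∃ (y : F.C k (Gluing.Y g)) (w : F.C k (Gluing.W g)),
      F.IsUnion (F.bd a) (F.du (Gluing.V_eq g) y (F.map (Gluing.φ g) y)) w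

/-- Boundary conditions: fields on the boundary, and a single one in dimension zero. -/
def BC : (k : ℕ) → PLMan k → Type v
  | 0, _ => PUnit
  | k + 1, X => F.C k X.bdry

/-- The boundary condition of a field. -/
def bc : {k : ℕ} → {X : PLMan k} → F.C k X → F.BC k X
  | 0, _, _ => PUnit.unit
  | _ + 1, _, a => F.bd a

/-- The fields on `X` with boundary condition `c`. -/
abbrev Fib (k : ℕ) (X : PLMan k) (c : F.BC k X) : Type v := {a : F.C k X // F.bc a = c}

/-- The boundary condition `c` is the disjoint union of `c₁` and `c₂`. -/
def IsDisjUnionBC : {k : ℕ} → {X X₁ X₂ : PLMan k} → F.BC k X → F.BC k X₁ → F.BC k X₂ → Prop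
  | 0, _, _, _, _, _, _ => True
  | _ + 1, X, X₁, X₂, c, c₁, c₂ => ∃ h : IsDisjUnion X.bdry X₁.bdry X₂.bdry, c = F.du h c₁ c₂

end FieldData

/-- An `n`-dimensional system of fields enriched over `R`-modules: functors from compact PL
manifolds of dimension `k ≤ n` and homeomorphisms to sets, with boundary restriction, disjoint
unions and gluing (with corners), the fields on an `n`-manifold with fixed boundary condition
forming an `R`-module. General position of fields (existence of splittings) and product fields are
not required, so that these systems include the ones that have them. -/
structure FieldSystem (R : Type u) [CommRing R] (n : ℕ) extends FieldData.{v} where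
  /-- Functoriality. -/
  map_id : ∀ {k : ℕ} {X : PLMan k} (f : PLEquiv X.carrier X.carrier) (a : C k X), k ≤ n →
    (∀ x, f x = x) → map f a = a
  map_comp : ∀ {k : ℕ} {X X' X'' : PLMan k} (f : PLEquiv X.carrier X'.carrier)
    (g : PLEquiv X'.carrier X''.carrier) (h : PLEquiv X.carrier X''.carrier) (a : C k X), k ≤ n →
    (∀ x, h x = g (f x)) → map h a = map g (map f a)
  /-- Naturality of the restriction to the boundary. -/
  bd_map : ∀ {k : ℕ} {X X' : PLMan (k + 1)} (f : PLEquiv X.carrier X'.carrier)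
    (g : PLEquiv X.bdry.carrier X'.bdry.carrier) (a : C (k + 1) X), k + 1 ≤ n →
    (∀ (x : X.bdry.carrier) (x' : X.carrier), x.1 = x'.1 → (g x).1 = (f x').1) →
    bd (map f a) = map g (bd a)
  /-- Enrichment. -/
  [group : ∀ (X : PLMan n) (c : toFieldData.BC n X), AddCommGroup (toFieldData.Fib n X c)]
  [mod : ∀ (X : PLMan n) (c : toFieldData.BC n X), Module R (toFieldData.Fib n X c)]
  map_linear : ∀ {X X' : PLMan n} (f : PLEquiv X.carrier X'.carrier) (c : toFieldData.BC n X)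
    (c' : toFieldData.BC n X'), (∀ a : toFieldData.Fib n X c, toFieldData.bc (map f a.1) = c') →
    ∃ A : toFieldData.Fib n X c →ₗ[R] toFieldData.Fib n X' c', ∀ a, (A a).1 = map f a.1
  /-- Disjoint union is symmetric, associative, unital, natural and compatible with boundaries. -/
  du_comm : ∀ {k : ℕ} {X X₁ X₂ : PLMan k} (h : IsDisjUnion X X₁ X₂) (h' : IsDisjUnion X X₂ X₁)
    (a : C k X₁) (b : C k X₂), k ≤ n → du h a b = du h' b a
  du_assoc : ∀ {k : ℕ} {X X₁ X₂ X₃ X₁₂ X₂₃ : PLMan k} (h₁ : IsDisjUnion X₁₂ X₁ X₂)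
    (h₂ : IsDisjUnion X X₁₂ X₃) (h₃ : IsDisjUnion X₂₃ X₂ X₃) (h₄ : IsDisjUnion X X₁ X₂₃)
    (a : C k X₁) (b : C k X₂) (c : C k X₃), k ≤ n →
    du h₂ (du h₁ a b) c = du h₄ a (du h₃ b c)
  du_empty : ∀ {k : ℕ} {X E : PLMan k} (h : IsDisjUnion X X E) (hE : E.carrier = ∅) (a : C k X),
    k ≤ n → du h a (empty hE) = a
  du_map : ∀ {k : ℕ} {X X₁ X₂ X' X₁' X₂' : PLMan k} (h : IsDisjUnion X X₁ X₂)
    (h' : IsDisjUnion X' X₁' X₂') (f : PLEquiv X.carrier X'.carrier)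
    (f₁ : PLEquiv X₁.carrier X₁'.carrier) (f₂ : PLEquiv X₂.carrier X₂'.carrier)
    (a : C k X₁) (b : C k X₂), k ≤ n →
    (∀ (x : X.carrier) (y : X₁.carrier), x.1 = y.1 → (f x).1 = (f₁ y).1) →
    (∀ (x : X.carrier) (y : X₂.carrier), x.1 = y.1 → (f x).1 = (f₂ y).1) →
    map f (du h a b) = du h' (map f₁ a) (map f₂ b)
  du_bd : ∀ {k : ℕ} {X X₁ X₂ : PLMan (k + 1)} (h : IsDisjUnion X X₁ X₂)
    (h' : IsDisjUnion X.bdry X₁.bdry X₂.bdry) (a : C (k + 1) X₁) (b : C (k + 1) X₂), k + 1 ≤ n →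
    bd (du h a b) = du h' (bd a) (bd b)
  map_empty : ∀ {k : ℕ} {E E' : PLMan k} (hE : E.carrier = ∅) (hE' : E'.carrier = ∅)
    (f : PLEquiv E.carrier E'.carrier), k ≤ n → map f (empty hE) = empty hE'
  /-- Below dimension `n`, fields on a disjoint union are pairs of fields. -/
  du_bij : ∀ {k : ℕ} {X X₁ X₂ : PLMan k} (h : IsDisjUnion X X₁ X₂), k < n →
    Function.Bijective fun p : C k X₁ × C k X₂ => du h p.1 p.2
  empty_unique : ∀ {k : ℕ} {E : PLMan k} (hE : E.carrier = ∅) (a : C k E), k < n → a = empty hE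
  /-- In dimension `n`, the fields on a disjoint union form the tensor product. -/
  du_tensor : ∀ {X X₁ X₂ : PLMan n} (h : IsDisjUnion X X₁ X₂) (c : toFieldData.BC n X)
    (c₁ : toFieldData.BC n X₁) (c₂ : toFieldData.BC n X₂), toFieldData.IsDisjUnionBC c c₁ c₂ →
    ∃ β : toFieldData.Fib n X₁ c₁ →ₗ[R] toFieldData.Fib n X₂ c₂ →ₗ[R] toFieldData.Fib n X c,
      (∀ a b, (β a b).1 = du h a.1 b.1) ∧ Function.Bijective (TensorProduct.lift β)
  empty_basis : ∀ {E : PLMan n} (hE : E.carrier = ∅), Function.Bijective fun r : R =>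
    r • (⟨empty hE, rfl⟩ : toFieldData.Fib n E (toFieldData.bc (empty hE)))
  /-- The gluing map is defined on the equalizer of the two restrictions to the seam. -/
  glue_dom : ∀ {k : ℕ} {X X' : PLMan k} (g : GlueStep k X X') (a : C k X), k ≤ n →
    ((∃ b, Glues g a b) ↔ toFieldData.Gluable g a)
  glue_fun : ∀ {k : ℕ} {X X' : PLMan k} (g : GlueStep k X X') (a : C k X) (b b' : C k X'), k ≤ n →
    Glues g a b → Glues g a b' → b = b'
  /-- The gluing map is injective, in dimension `n` on each module `C(X; c)`. -/
  glue_inj : ∀ {k : ℕ} {X X' : PLMan k} (g : GlueStep k X X') (a a' : C k X) (b : C k X'), k ≤ n →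
    (k < n ∨ toFieldData.bc a = toFieldData.bc a') → Glues g a b → Glues g a' b → a = a'
  /-- In dimension `n` the gluing map is linear. -/
  glue_add : ∀ {X X' : PLMan n} (g : GlueStep n X X') (c : toFieldData.BC n X)
    (c' : toFieldData.BC n X') (a₁ a₂ : toFieldData.Fib n X c) (b₁ b₂ : toFieldData.Fib n X' c'),
    Glues g a₁.1 b₁.1 → Glues g a₂.1 b₂.1 → Glues g (a₁ + a₂).1 (b₁ + b₂).1
  glue_smul : ∀ {X X' : PLMan n} (g : GlueStep n X X') (c : toFieldData.BC n X)
    (c' : toFieldData.BC n X') (r : R) (a : toFieldData.Fib n X c) (b : toFieldData.Fib n X' c'),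
    Glues g a.1 b.1 → Glues g (r • a).1 (r • b).1
  /-- Gluing is natural. -/
  glue_map : ∀ {k : ℕ} {X X' Z Z' : PLMan k} (g : GlueStep k X X') (g₂ : GlueStep k Z Z')
    (f : PLEquiv X.carrier Z.carrier) (f' : PLEquiv X'.carrier Z'.carrier) (a : C k X)
    (b : C k X'), k ≤ n → (∀ x, f' (g.q x) = g₂.q (f x)) →
    (∀ x, (f x).1 ∈ g₂.left ↔ x.1 ∈ g.left) → (∀ x, (f x).1 ∈ g₂.right ↔ x.1 ∈ g.right) →
    Glues g a b → Glues g₂ (map f a) (map f' b)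
  /-- Gluing is compatible with disjoint unions. -/
  glue_du : ∀ {k : ℕ} {X X' Z XZ XZ' : PLMan k} (g : GlueStep k X X') (g₂ : GlueStep k XZ XZ')
    (h : IsDisjUnion XZ X Z) (h' : IsDisjUnion XZ' X' Z) (a : C k X) (b : C k X') (z : C k Z),
    k ≤ n → (∀ (x : XZ.carrier) (y : X.carrier), x.1 = y.1 → (g₂.q x).1 = (g.q y).1) →
    (∀ x : XZ.carrier, x.1 ∈ Z.carrier → (g₂.q x).1 = x.1) →
    g₂.left = g.left → g₂.right = g.right →
    Glues g a b → Glues g₂ (du h a z) (du h' b z)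
  /-- Gluing is compatible with boundaries: the boundary of the glued field is the field on the
  rest of the boundary, glued along the boundary of the seam. -/
  glue_bd : ∀ {k : ℕ} {X X' : PLMan (k + 1)} (g : Gluing X X') (a : C (k + 1) X)
    (b : C (k + 1) X') (y : C k g.Y) (w : C k g.W), k + 1 ≤ n →
    Glues (k := k + 1) (X := X) (X' := X') g a b →
    toFieldData.IsUnion (bd a) (du g.V_eq y (map g.φ y)) w →
    ∃ s : GlueSeq g.W X'.bdry,
      (∀ (x : g.W.carrier) (x' : X.carrier), x.1 = x'.1 → (s.map x).1 = (g.q x').1) ∧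
      toFieldData.SeqGlues s w (bd b)
  /-- Gluing is strictly associative: the result depends only on the total quotient map. -/
  glue_assoc : ∀ {k : ℕ} {X Z : PLMan k} (s s' : GlueSeq X Z) (a : C k X) (b b' : C k Z), k ≤ n →
    s.map = s'.map → toFieldData.SeqGlues s a b → toFieldData.SeqGlues s' a b' → b = b'

attribute [instance] FieldSystem.group FieldSystem.mod

variable {R : Type u} [CommRing R] {n : ℕ}

/-- Local relations: a submodule of the fields on each `n`-ball with boundary condition. -/
structure LocalRelations (F : FieldSystem.{u, v} R n) where
  U : (B : PLMan n) → B.IsBall → (c : F.BC n B) → Submodule R (F.Fib n B c)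
  /-- Functoriality. -/
  map_mem : ∀ {B B' : PLMan n} (hB : B.IsBall) (hB' : B'.IsBall)
    (f : PLEquiv B.carrier B'.carrier) (c : F.BC n B) (c' : F.BC n B') (u : F.Fib n B c)
    (u' : F.Fib n B' c'), u'.1 = F.map f u.1 → (u ∈ U B hB c ↔ u' ∈ U B' hB' c')
  /-- Local relations form an ideal: if the ball `B` is the result of gluing together the ball `B'`
  and the manifold `B''`, then gluing a local relation `u` on `B'` to a field `r` on `B''` gives a
  local relation on `B`. -/
  ideal : ∀ {B B' B'' D : PLMan n} (hB : B.IsBall) (hB' : B'.IsBall) (h : IsDisjUnion D B' B'')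
    (s : GlueSeq D B) (c : F.BC n B) (c' : F.BC n B') (u : F.Fib n B' c') (r : F.C n B'')
    (x : F.Fib n B c), u ∈ U B' hB' c' → F.SeqGlues s (F.du h u.1 r) x.1 → x ∈ U B hB c

/-- The field `u` on the ball `B` is a local relation. -/
def LocalRelations.Mem {F : FieldSystem.{u, v} R n} (U : LocalRelations F) {B : PLMan n}
    (hB : B.IsBall) (u : F.C n B) : Prop :=
  (⟨u, rfl⟩ : F.Fib n B (F.bc u)) ∈ U.U B hB (F.bc u)

/-! ### The skein module -/

/-- The local relations on `X` with boundary condition `c`: the span of the fields `u • r` with `u`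
a local relation on an embedded ball `B` and `r` a field on the rest `E` of `X`. -/
def LocalRelations.skeinRel {F : FieldSystem.{u, v} R n} (U : LocalRelations F) (X : PLMan n)
    (c : F.BC n X) : Submodule R (F.Fib n X c) :=
  Submodule.span R {x | ∃ (B E D : PLMan n) (hB : B.IsBall) (h : IsDisjUnion D B E)
    (s : GlueSeq D X) (u : F.C n B) (r : F.C n E), Set.InjOn s.map {x | x.1 ∈ B.carrier} ∧
    Set.InjOn s.map {x | x.1 ∈ E.carrier} ∧ U.Mem hB u ∧ F.SeqGlues s (F.du h u r) x.1}

/-- The skein module `A(X; c)`: fields modulo local relations. -/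
abbrev LocalRelations.Skein {F : FieldSystem.{u, v} R n} (U : LocalRelations F) (X : PLMan n)
    (c : F.BC n X) : Type v := F.Fib n X c ⧸ U.skeinRel X c

/-! ### Blob diagrams -/

/-- A field on `M` that is the product of fields on the connected components of `M`, given by its
restrictions to all unions of components. -/
structure SplitField (F : FieldSystem.{u, v} R n) (M : PLMan n) where
  val : (P : PLMan n) → IsPart P M → F.C n P
  mul : ∀ {P Q T : PLMan n} (hP : IsPart P M) (hQ : IsPart Q M) (hT : IsPart T M)
    (h : IsDisjUnion T P Q), val T hT = F.du h (val P hP) (val Q hQ)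

/-- The split field `a'` on `M'` is the result of gluing the split field `a` on `M`: this holds over
every union `P'` of components of `M'` and its preimage `P` in `M`. -/
def GluesSplit (F : FieldSystem.{u, v} R n) {M M' : PLMan n} (g : GlueStep n M M')
    (a : SplitField F M) (a' : SplitField F M') : Prop :=
  ∀ (P' : PLMan n) (hP' : IsPart P' M'), ∃ (P : PLMan n) (hP : IsPart P M),
    (∀ x : M.carrier, x.1 ∈ P.carrier ↔ (g.q x).1 ∈ P'.carrier) ∧
    ∃ g' : GlueStep n P P',
      (∀ (x : P.carrier) (x' : M.carrier), x.1 = x'.1 → (g'.q x).1 = (g.q x').1) ∧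
      g'.left = g.left ∩ P.carrier ∧ g'.right = g.right ∩ P.carrier ∧
      F.Glues g' (a.val P hP) (a'.val P' hP')

/-- A gluing decomposition `M = M₀ → ⋯ → M_m = X` with a field on `M` that is a product over the
components of `M`, and the fields on the `M_l` obtained from it by gluing. -/
inductive SplitSeq (F : FieldSystem.{u, v} R n) :
    {M X : PLMan n} → SplitField F M → SplitField F X → Type v
  | nil {X : PLMan n} (a : SplitField F X) : SplitSeq F a a
  | cons {M M' X : PLMan n} {a : SplitField F M} {a' : SplitField F M'} {b : SplitField F X}
      (g : GlueStep n M M') (h : GluesSplit F g a a') (S : SplitSeq F a' b) : SplitSeq F a b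

namespace SplitSeq

variable {F : FieldSystem.{u, v} R n}

/-- The quotient map `M₀ → X`. -/
def map : {M X : PLMan n} → {a : SplitField F M} → {b : SplitField F X} → SplitSeq F a b →
    M.carrier → X.carrier
  | _, _, _, _, .nil _ => id
  | _, _, _, _, .cons g _ S => S.map ∘ g.q

/-- The image in `X` of a subset of `M₀`. -/
def image {M X : PLMan n} {a : SplitField F M} {b : SplitField F X} (S : SplitSeq F a b)
    (K : Set Pt) : Set Pt := {p | ∃ x : M.carrier, x.1 ∈ K ∧ (S.map x).1 = p}

/-- `K` is a union of components of one of the `M_l` with image `B` in `X`, and `u` is the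
restriction to `K` of the field on that `M_l`. -/
def Occurs : {M X : PLMan n} → {a : SplitField F M} → {b : SplitField F X} → SplitSeq F a b →
    (B : Set Pt) → (K : PLMan n) → (u : F.C n K) → Prop
  | X, _, _, _, .nil c, B, K, u => ∃ h : IsPart K X, u = c.val K h ∧ B = K.carrier
  | M, _, a, _, .cons g h S, B, K, u =>
      (∃ hK : IsPart K M, u = a.val K hK ∧ B = (SplitSeq.cons g h S).image K.carrier) ∨
        S.Occurs B K u

end SplitSeq

/-- `B i` is a twig blob: no other blob is strictly contained in it. -/
def IsTwig {k : ℕ} (B : Fin k → Set Pt) (i : Fin k) : Prop := ∀ j, ¬ B j ⊂ B i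

/-- `(B, r)` is a `k`-blob diagram on `X`: there is a gluing decomposition of `X`, along which the
field `r` splits, such that each blob `B i` is the image of a connected component `K` of some `M_l`
that is a ball, and if `B i` is a twig blob then the restriction of `r` to `K` is a local relation.
(A union of components that is a ball is a single component.) -/
def IsBlobDiagram {F : FieldSystem.{u, v} R n} (U : LocalRelations F) {X : PLMan n} {k : ℕ}
    (B : Fin k → Set Pt) (r : F.C n X) : Prop :=
  ∃ (M : PLMan n) (a : SplitField F M) (b : SplitField F X) (hX : IsPart X X) (S : SplitSeq F a b),
    b.val X hX = r ∧ ∀ i, ∃ (K : PLMan n) (hK : K.IsBall) (u : F.C n K),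
      S.Occurs (B i) K u ∧ (IsTwig B i → U.Mem hK u)

/-- The module of blob diagrams on `X` with boundary condition `c` and configuration `B`. -/
def diagrams {F : FieldSystem.{u, v} R n} (U : LocalRelations F) (X : PLMan n) (c : F.BC n X)
    {k : ℕ} (B : Fin k → Set Pt) : Submodule R (F.Fib n X c) :=
  Submodule.span R {r | IsBlobDiagram U B r.1}

/-! ### Forgetting a blob

The remaining facts show that forgetting a blob from a blob diagram gives a blob diagram. -/

theorem subset_of_preconnected {N C C' : Set Pt} (hN : IsPreconnected N) (hC : IsClosed C)
    (hC' : IsClosed C') (hd : Disjoint C C') (hsub : N ⊆ C ∪ C') (hne : (N ∩ C).Nonempty) :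
    N ⊆ C := by
  intro x hx
  by_contra hxC
  have hx' : x ∈ C' := (hsub hx).resolve_left hxC
  obtain ⟨z, -, hz, hz'⟩ := isPreconnected_closed_iff.1 hN C C' hC hC' hsub hne ⟨x, hx, hx'⟩
  exact Set.disjoint_left.1 hd hz hz'

theorem IsPolyhedron.isCompact {X : Set Pt} (h : IsPolyhedron X) : IsCompact X := by
  obtain ⟨T, rfl⟩ := h
  exact T.isCompact_biUnion fun s _ => s.finite_toSet.isCompact_convexHull ℝ

theorem IsPLMfd.polyhedron : {k : ℕ} → {X : Set Pt} → IsPLMfd k X → IsPolyhedron X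
  | 0, _, h => h.1
  | _ + 1, _, h => h.1

theorem IsPLMfd.chart : {k : ℕ} → {X : Set Pt} → IsPLMfd k X → ∀ x ∈ X, HasChart k X x
  | 0, _, h => h.2
  | _ + 1, _, h => h.2.1

theorem IsPLMfd.isClosed {k : ℕ} {X : Set Pt} (h : IsPLMfd k X) : IsClosed X :=
  h.polyhedron.isCompact.isClosed

theorem cube_convex (k : ℕ) : Convex ℝ (cube k) := by
  rintro x ⟨hx, hx'⟩ y ⟨hy, hy'⟩ a b ha hb hab
  refine ⟨fun i hi => ⟨?_, ?_⟩, fun i hi => ?_⟩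
  · have := (hx i hi).1
    have := (hy i hi).1
    simp only [Pi.add_apply, Pi.smul_apply, smul_eq_mul]
    positivity
  · have h1 := (hx i hi).2
    have h2 := (hy i hi).2
    simp only [Pi.add_apply, Pi.smul_apply, smul_eq_mul]
    nlinarith
  · simp [hx' i hi, hy' i hi]

theorem PLEquiv.preconnected {N : Set Pt} {k : ℕ} (f : PLEquiv N (cube k)) :
    IsPreconnected N := by
  have h1 : PreconnectedSpace (cube k) := isPreconnected_iff_preconnectedSpace.1
    (cube_convex k).isPreconnected
  have h2 : PreconnectedSpace N :=
    f.toEquiv.symm.surjective.denseRange.preconnectedSpace f.pl_symm.1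
  exact isPreconnected_iff_preconnectedSpace.2 h2

/-- A union of components of a manifold is a manifold. -/
theorem IsPLMfd.of_disjoint_union : {k : ℕ} → {X C C' : Set Pt} → IsPLMfd k X → IsClosed C →
    IsClosed C' → Disjoint C C' → X = C ∪ C' → IsPLMfd k C := by
  intro k
  induction k with
  | zero => ?_
  | succ k ih => ?_
  all_goals
    intro X C C' hX hC hC' hd hu
    have hsub : C ⊆ X := hu ▸ Set.subset_union_left
    have hpoly : IsPolyhedron C := by
      classical
      obtain ⟨T, hT⟩ := hX.polyhedron
      refine ⟨T.filter fun s => convexHull ℝ (s : Set Pt) ⊆ C, ?_⟩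
      ext x
      simp only [Set.mem_iUnion, Finset.mem_filter, exists_prop]
      constructor
      · intro hx
        have hx' := hsub hx
        rw [hT] at hx'
        simp only [Set.mem_iUnion, exists_prop] at hx'
        obtain ⟨s, hs, hxs⟩ := hx'
        refine ⟨s, ⟨hs, subset_of_preconnected (convex_convexHull ℝ _).isPreconnected hC hC' hd ?_
          ⟨x, hxs, hx⟩⟩, hxs⟩
        rw [← hu, hT]
        exact Set.subset_biUnion_of_mem (u := fun s : Finset Pt => convexHull ℝ (s : Set Pt)) hs
      · rintro ⟨s, ⟨_, h⟩, hx⟩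
        exact h hx
    have hN : ∀ (x : Pt) (N : Set Pt) (j : ℕ), x ∈ C → N ⊆ X → N ∈ 𝓝[X] x →
        PLEquiv N (cube j) → N ⊆ C := by
      intro x N j hx hNX hN f
      exact subset_of_preconnected f.preconnected hC hC' hd (hu ▸ hNX)
        ⟨x, mem_of_mem_nhdsWithin (hsub hx) hN, hx⟩
    have hchart : ∀ j, (∀ x ∈ X, HasChart j X x) → ∀ x ∈ C, HasChart j C x := by
      rintro j h x hx
      obtain ⟨N, hNX, hNn, ⟨f⟩⟩ := h x (hsub hx)
      exact ⟨N, hN x N j hx hNX hNn f, nhdsWithin_mono x hsub hNn, ⟨f⟩⟩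
  · exact ⟨hpoly, hchart 0 hX.2⟩
  · have hmem : ∀ x ∈ C, C ∈ 𝓝[X] x := by
      intro x hx
      refine mem_nhdsWithin.2 ⟨C'ᶜ, hC'.isOpen_compl, Set.disjoint_left.1 hd hx, ?_⟩
      rintro y ⟨hy, hy'⟩
      rw [hu] at hy'
      exact hy'.resolve_right hy
    have hint : ∀ x ∈ C, (IsInteriorPt (k + 1) C x ↔ IsInteriorPt (k + 1) X x) := by
      intro x hx
      constructor
      · rintro ⟨N, hNC, hNn, f⟩
        refine ⟨N, hNC.trans hsub, ?_, f⟩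
        exact nhdsWithin_le_of_mem (hmem x hx) hNn
      · rintro ⟨N, hNX, hNn, f, hx', hf⟩
        exact ⟨N, hN x N _ hx hNX hNn f, nhdsWithin_mono x hsub hNn, f, hx', hf⟩
    have hb : bdrySet (k + 1) C = bdrySet (k + 1) X ∩ C := by
      ext x
      constructor
      · rintro ⟨hx, h⟩
        exact ⟨⟨hsub hx, fun h' => h ((hint x hx).2 h')⟩, hx⟩
      · rintro ⟨⟨_, h⟩, hx⟩
        exact ⟨hx, fun h' => h ((hint x hx).1 h')⟩
    refine ⟨hpoly, hchart _ hX.2.1, ?_⟩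
    rw [hb]
    have hbX := hX.2.2.isClosed
    refine ih hX.2.2 (hbX.inter hC) (hbX.inter hC') (hd.mono Set.inter_subset_right
      Set.inter_subset_right) ?_
    rw [← Set.inter_union_distrib_left, ← hu]
    exact (Set.inter_eq_left.2 fun x hx => hx.1).symm

namespace PLMan

variable {k : ℕ}

theorem isClosed (X : PLMan k) : IsClosed X.carrier := X.isMfd.isClosed

theorem isCompact (X : PLMan k) : IsCompact X.carrier := X.isMfd.polyhedron.isCompact

instance (X : PLMan k) : CompactSpace X.carrier := isCompact_iff_compactSpace.1 X.isCompact

theorem IsBall.preconnected {K : PLMan k} (h : K.IsBall) : IsPreconnected K.carrier := by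
  obtain ⟨f⟩ := h
  exact f.preconnected

theorem IsBall.nonempty {K : PLMan k} (h : K.IsBall) : K.carrier.Nonempty := by
  obtain ⟨f⟩ := h
  exact ⟨_, (f.toEquiv.symm ⟨0, by simp [cube]⟩).2⟩

theorem IsDisjUnion.symm {X X₁ X₂ : PLMan k} (h : IsDisjUnion X X₁ X₂) :
    IsDisjUnion X X₂ X₁ := ⟨h.1.symm, by rw [h.2, Set.union_comm]⟩

theorem IsPart.subset {P M : PLMan k} (h : IsPart P M) : P.carrier ⊆ M.carrier := by
  obtain ⟨Q, h⟩ := h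
  rw [h.2]
  exact Set.subset_union_left

theorem isPart_of_closed {M : PLMan k} {C C' : Set Pt} (hC : IsClosed C) (hC' : IsClosed C')
    (hd : Disjoint C C') (hu : M.carrier = C ∪ C') :
    ∃ P Q : PLMan k, P.carrier = C ∧ Q.carrier = C' ∧ IsDisjUnion M P Q :=
  ⟨⟨C, M.isMfd.of_disjoint_union hC hC' hd hu⟩,
    ⟨C', M.isMfd.of_disjoint_union hC' hC hd.symm (hu.trans (Set.union_comm _ _))⟩, rfl, rfl, hd, hu⟩

theorem IsPart.refl (M : PLMan k) : IsPart M M := by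
  obtain ⟨P, Q, hP, -, h⟩ := isPart_of_closed (M := M) M.isClosed isClosed_empty
    (Set.disjoint_empty _) (Set.union_empty _).symm
  obtain rfl : P = M := PLMan.ext hP
  exact ⟨Q, h⟩

/-- A part contained in another part has a complementary part there. -/
theorem IsPart.diff {K P M : PLMan k} (hK : IsPart K M) (hP : IsPart P M)
    (h : K.carrier ⊆ P.carrier) : ∃ Q, IsDisjUnion P K Q ∧ IsPart Q M := by
  obtain ⟨K', hK'⟩ := hK
  obtain ⟨P', hP'⟩ := hP
  have hPM : P.carrier ⊆ M.carrier := IsPart.subset ⟨P', hP'⟩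
  have e1 : P.carrier = K.carrier ∪ P.carrier ∩ K'.carrier := by
    ext x
    constructor
    · intro hx
      have := hPM hx
      rw [hK'.2] at this
      exact this.imp id fun h' => ⟨hx, h'⟩
    · rintro (hx | hx)
      exacts [h hx, hx.1]
  obtain ⟨K₂, Q, hK₂, hQ, hPKQ⟩ := isPart_of_closed (M := P) K.isClosed
    (P.isClosed.inter K'.isClosed) (hK'.1.mono_right Set.inter_subset_right) e1
  obtain rfl : K₂ = K := PLMan.ext hK₂
  refine ⟨Q, hPKQ, ?_⟩
  obtain ⟨Q₂, Q', hQ₂, -, hQQ⟩ := isPart_of_closed (M := M) (C := Q.carrier)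
    (C' := K₂.carrier ∪ P'.carrier) Q.isClosed (K₂.isClosed.union P'.isClosed) (by
      rw [Set.disjoint_union_right]
      refine ⟨hPKQ.1.symm, hP'.1.mono_left ?_⟩
      rw [hQ]
      exact Set.inter_subset_left) (by
      rw [hP'.2, hPKQ.2, ← Set.union_assoc, Set.union_comm Q.carrier])
  obtain rfl : Q₂ = Q := PLMan.ext hQ₂
  exact ⟨Q', hQQ⟩

/-- A part meeting a connected part contains it. -/
theorem IsPart.subset_of_meets {K P M : PLMan k} (hK : IsPart K M) (hc : IsPreconnected K.carrier)
    (hP : IsPart P M) (hne : (K.carrier ∩ P.carrier).Nonempty) : K.carrier ⊆ P.carrier := by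
  obtain ⟨P', hP'⟩ := hP
  exact subset_of_preconnected hc P.isClosed P'.isClosed hP'.1 (hP'.2 ▸ hK.subset) hne

theorem IsPart.isOpen {P M : PLMan k} (hP : IsPart P M) :
    IsOpen {x : M.carrier | x.1 ∈ P.carrier} := by
  obtain ⟨P', hP'⟩ := hP
  have : {x : M.carrier | x.1 ∈ P.carrier} = {x : M.carrier | x.1 ∈ P'.carrier}ᶜ := by
    ext x
    constructor
    · exact fun h h' => Set.disjoint_left.1 hP'.1 h h'
    · intro h
      have hx : x.1 ∈ P.carrier ∪ P'.carrier := hP'.2.subset x.2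
      exact hx.resolve_right h
  rw [this]
  exact (P'.isClosed.preimage continuous_subtype_val).isOpen_compl

/-- The boundary of a manifold is nowhere dense. -/
theorem exists_not_mem_bdrySet (X : PLMan k) (O : Set X.carrier) (hO : IsOpen O)
    (hne : O.Nonempty) : ∃ x ∈ O, x.1 ∉ bdrySet k X.carrier := by
  obtain ⟨x, hx⟩ := hne
  obtain ⟨O', hO', rfl⟩ := isOpen_induced_iff.1 hO
  obtain ⟨N, hNX, hN, ⟨f⟩⟩ := X.isMfd.chart x.1 x.2
  have hxN : x.1 ∈ N := mem_of_mem_nhdsWithin x.2 hN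
  obtain ⟨V, hV, hxV, hVN⟩ := mem_nhdsWithin.1 hN
  have hp := (f ⟨x.1, hxN⟩).2
  set p : Pt := (f ⟨x.1, hxN⟩).1 with hpdef
  let m : Pt := fun i => if i < k then 1 / 2 else 0
  let γ : ℝ → Pt := fun t => (1 - t) • p + t • m
  have hγ : Continuous γ := by fun_prop
  have hγ0 : γ 0 = p := by simp [γ]
  have hmem : ∀ t, 0 < t → t ≤ 1 → γ t ∈ openCube k := by
    intro t h0 h1
    refine ⟨fun i hi => ?_, fun i hi => ?_⟩
    · have h2 := hp.1 i hi
      simp only [γ, m, Pi.add_apply, Pi.smul_apply, smul_eq_mul, hi, if_true]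
      constructor <;> nlinarith
    · simp [γ, m, hp.2 i hi, hi]
  have hsub : openCube k ⊆ cube k := fun y hy =>
    ⟨fun i hi => ⟨(hy.1 i hi).1.le, (hy.1 i hi).2.le⟩, hy.2⟩
  have hmem' : ∀ t ∈ Set.Icc (0 : ℝ) 1, γ t ∈ cube k := by
    rintro t ⟨h0, h1⟩
    rcases h0.eq_or_lt with rfl | h0
    · rw [hγ0]; exact hp
    · exact hsub (hmem t h0 h1)
  let δ : Set.Icc (0 : ℝ) 1 → N := fun t => f.toEquiv.symm ⟨γ t, hmem' t t.2⟩
  have hδ : Continuous fun t => (δ t).1 :=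
    continuous_subtype_val.comp (f.pl_symm.1.comp
      ((hγ.comp continuous_subtype_val).subtype_mk _))
  have hδ0 : (δ 0).1 = x.1 := by
    have : (⟨γ (0 : Set.Icc (0 : ℝ) 1), hmem' _ (0 : Set.Icc (0 : ℝ) 1).2⟩ : cube k) =
        f ⟨x.1, hxN⟩ := Subtype.ext (by simpa using hγ0)
    simp only [δ, this]
    exact congrArg Subtype.val (f.toEquiv.symm_apply_apply _)
  have hev : ∀ᶠ t in 𝓝 (0 : Set.Icc (0 : ℝ) 1), (δ t).1 ∈ O' ∩ V :=
    hδ.continuousAt.eventually_mem ((hO'.inter hV).mem_nhds (by rw [hδ0]; exact ⟨hx, hxV⟩))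
  obtain ⟨ε, hε, hball⟩ := Metric.eventually_nhds_iff.1 hev
  let t : Set.Icc (0 : ℝ) 1 := ⟨min (ε / 2) 1, by positivity, min_le_right _ _⟩
  have ht0 : 0 < t.1 := by simp only [t]; positivity
  have ht : (δ t).1 ∈ O' ∩ V := by
    apply hball
    rw [Subtype.dist_eq, Real.dist_eq]
    have : t.1 ≤ ε / 2 := min_le_left _ _
    simp only [Set.Icc.coe_zero, sub_zero, abs_of_pos ht0]
    linarith
  refine ⟨⟨(δ t).1, hNX (δ t).2⟩, ht.1, fun h => h.2 ⟨N, hNX, ?_, f, (δ t).2, ?_⟩⟩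
  · exact mem_nhdsWithin.2 ⟨V, hV, ht.2, hVN⟩
  · have : f (δ t) = ⟨γ t, hmem' t t.2⟩ := f.toEquiv.apply_symm_apply _
    change (f (δ t)).1 ∈ _
    rw [this]
    exact hmem t.1 ht0 t.2.2

end PLMan

namespace GlueStep

theorem continuous_q : {k : ℕ} → {X X' : PLMan k} → (g : GlueStep k X X') → Continuous g.q
  | 0, _, _, g => nomatch g
  | _ + 1, _, _, g => (Gluing.q_pl g).1

theorem surjective_q : {k : ℕ} → {X X' : PLMan k} → (g : GlueStep k X X') →
    Function.Surjective g.q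
  | 0, _, _, g => nomatch g
  | _ + 1, _, _, g => Gluing.q_surj g

theorem seam_subset : {k : ℕ} → {X X' : PLMan k} → (g : GlueStep k X X') →
    g.left ∪ g.right ⊆ bdrySet k X.carrier
  | 0, _, _, g => nomatch g
  | _ + 1, X, _, g => by
    have h := Gluing.cover g
    have h' := (Gluing.V_eq g).2
    change _ = bdrySet _ X.carrier at h
    rw [← h, h']
    exact Set.subset_union_left

theorem isClosed_seam : {k : ℕ} → {X X' : PLMan k} → (g : GlueStep k X X') →
    IsClosed (g.left ∪ g.right)
  | 0, _, _, g => nomatch g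
  | _ + 1, _, _, g => (Gluing.Y g).isClosed.union (Gluing.Y' g).isClosed

theorem eq_of_q_eq : {k : ℕ} → {X X' : PLMan k} → (g : GlueStep k X X') → (x x' : X.carrier) →
    x.1 ∉ g.left ∪ g.right → g.q x = g.q x' → x = x'
  | 0, _, _, g => nomatch g
  | _ + 1, _, _, g => by
    intro x x' hx h
    rcases (Gluing.q_eq g x x').1 h with h | ⟨y, ⟨h, -⟩ | ⟨-, h⟩⟩
    · exact h
    · exact absurd (Or.inl (h ▸ y.2)) hx
    · refine absurd (Or.inr ?_) hx
      rw [h]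
      exact Subtype.coe_prop _

/-- Off the seam the quotient map is open. -/
theorem isOpen_image {k : ℕ} {X X' : PLMan k} (g : GlueStep k X X') (O : Set X.carrier)
    (hO : IsOpen O) (hd : ∀ x ∈ O, x.1 ∉ g.left ∪ g.right) : IsOpen (g.q '' O) := by
  have h : g.q '' O = (g.q '' Oᶜ)ᶜ := by
    ext y
    constructor
    · rintro ⟨x, hx, rfl⟩ ⟨x', hx', h⟩
      exact hx' (g.eq_of_q_eq x x' (hd x hx) h.symm ▸ hx)
    · intro hy
      obtain ⟨x, rfl⟩ := g.surjective_q y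
      by_contra hx
      exact hy ⟨x, fun h => hx ⟨x, h, rfl⟩, rfl⟩
  rw [h]
  exact (g.continuous_q.isClosedMap _ hO.isClosed_compl).isOpen_compl

end GlueStep

theorem isPL_id {X : Set Pt} (h : IsPolyhedron X) : IsPL (id : X → X) := by
  obtain ⟨T, hT⟩ := h
  exact ⟨continuous_id, T, hT, fun _ _ => ⟨AffineMap.id ℝ Pt, fun _ _ => rfl⟩⟩

/-- The identity of a manifold. -/
def PLEquiv.refl {k : ℕ} (X : PLMan k) : PLEquiv X.carrier X.carrier where
  toEquiv := Equiv.refl _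
  pl := isPL_id X.isMfd.polyhedron
  pl_symm := isPL_id X.isMfd.polyhedron

namespace SplitSeq

variable {F : FieldSystem.{u, v} R n}

theorem surjective_map : {M X : PLMan n} → {a : SplitField F M} → {b : SplitField F X} →
    (S : SplitSeq F a b) → Function.Surjective S.map
  | _, _, _, _, .nil _ => Function.surjective_id
  | _, _, _, _, .cons g _ S => S.surjective_map.comp g.surjective_q

/-- The points of `M` that are never identified with other points are dense. -/
theorem exists_generic {M X : PLMan n} {a : SplitField F M} {b : SplitField F X}
    (S : SplitSeq F a b) : ∀ O : Set M.carrier, IsOpen O → O.Nonempty →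
      ∃ x ∈ O, ∀ x', S.map x = S.map x' → x = x' := by
  induction S with
  | nil a =>
    rintro O - ⟨x, hx⟩
    exact ⟨x, hx, fun _ h => h⟩
  | cons g h S ih =>
    intro O hO hne
    obtain ⟨y, hy, hyb⟩ := PLMan.exists_not_mem_bdrySet _ O hO hne
    have hO' : IsOpen (O ∩ {x | x.1 ∉ g.left ∪ g.right}) :=
      hO.inter ((g.isClosed_seam.isOpen_compl).preimage continuous_subtype_val)
    obtain ⟨_, ⟨x, hx, rfl⟩, hxg⟩ := ih _ (g.isOpen_image _ hO' fun x hx => hx.2)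
      ⟨_, y, ⟨hy, fun h => hyb (g.seam_subset h)⟩, rfl⟩
    exact ⟨x, hx.1, fun x' h' => g.eq_of_q_eq x x' hx.2 (hxg _ h')⟩

/-- If the image of a nonempty part is contained in the image of another part, the parts meet. -/
theorem meets {M X : PLMan n} {a : SplitField F M} {b : SplitField F X}
    (S : SplitSeq F a b) {P P' : PLMan n} (hP : IsPart P M) (hne : P.carrier.Nonempty)
    (h : S.image P.carrier ⊆ S.image P'.carrier) : (P.carrier ∩ P'.carrier).Nonempty := by
  obtain ⟨p, hp⟩ := hne
  obtain ⟨x, hx, hg⟩ := S.exists_generic _ hP.isOpen ⟨⟨p, hP.subset hp⟩, hp⟩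
  obtain ⟨x', hx', he⟩ := h ⟨x, hx, rfl⟩
  obtain rfl := hg x' (Subtype.ext he.symm)
  exact ⟨x.1, hx, hx'⟩

theorem image_cons {M M' X : PLMan n} {a : SplitField F M} {a' : SplitField F M'}
    {b : SplitField F X} (g : GlueStep n M M') (h : GluesSplit F g a a') (S : SplitSeq F a' b)
    {P P' : Set Pt} (hP : ∀ x : M.carrier, x.1 ∈ P ↔ (g.q x).1 ∈ P') :
    (SplitSeq.cons g h S).image P = S.image P' := by
  ext p
  constructor
  · rintro ⟨x, hx, hp⟩
    exact ⟨g.q x, (hP x).1 hx, hp⟩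
  · rintro ⟨y, hy, hp⟩
    obtain ⟨x, rfl⟩ := g.surjective_q y
    exact ⟨x, (hP x).2 hy, hp⟩

theorem seqGlues_refl (K : PLMan n) (u : F.C n K) : F.SeqGlues (.iso (PLEquiv.refl K)) u u :=
  (F.map_id _ u le_rfl fun _ => rfl).symm

/-- A component occurring in a sequence of gluings is glued from a part of the first manifold. -/
theorem Occurs.exists_part {M X : PLMan n} {a : SplitField F M} {b : SplitField F X}
    {S : SplitSeq F a b} : ∀ {B : Set Pt} {K : PLMan n} {u : F.C n K}, S.Occurs B K u →
      K.carrier.Nonempty → ∃ (P : PLMan n) (hP : IsPart P M) (t : GlueSeq P K),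
        P.carrier.Nonempty ∧ S.image P.carrier = B ∧ F.SeqGlues t (a.val P hP) u := by
  induction S with
  | nil a =>
    rintro B K u ⟨hK, rfl, rfl⟩ hne
    refine ⟨K, hK, .iso (PLEquiv.refl K), hne, ?_, seqGlues_refl K _⟩
    ext p
    constructor
    · rintro ⟨x, hx, rfl⟩
      exact hx
    · exact fun hp => ⟨⟨p, hK.subset hp⟩, hp, rfl⟩
  | cons g h S ih =>
    rintro B K u (⟨hK, rfl, rfl⟩ | hB) hne
    · exact ⟨K, hK, .iso (PLEquiv.refl K), hne, rfl, seqGlues_refl K _⟩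
    · obtain ⟨P', hP', t, hne', rfl, ht⟩ := ih hB hne
      obtain ⟨P, hP, hPP', g', -, -, -, hg'⟩ := h P' hP'
      refine ⟨P, hP, .cons g' t, ?_, image_cons g h S hPP', _, hg', ht⟩
      obtain ⟨p, hp⟩ := hne'
      obtain ⟨x, hx⟩ := g.surjective_q ⟨p, hP'.subset hp⟩
      exact ⟨x.1, (hPP' x).2 (by rw [hx]; exact hp)⟩

/-- A blob strictly containing a blob labelled by a local relation is labelled by one. -/
theorem Occurs.mem_of_ssubset (U : LocalRelations F) {M X : PLMan n} {a : SplitField F M}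
    {b : SplitField F X} {S : SplitSeq F a b} : ∀ {B₁ B₂ : Set Pt} {K₁ K₂ : PLMan n}
      {u₁ : F.C n K₁} {u₂ : F.C n K₂} (hK₁ : K₁.IsBall) (hK₂ : K₂.IsBall), S.Occurs B₁ K₁ u₁ →
      S.Occurs B₂ K₂ u₂ → B₁ ⊂ B₂ → U.Mem hK₁ u₁ → U.Mem hK₂ u₂ := by
  have main : ∀ {M X : PLMan n} {a : SplitField F M} {b : SplitField F X} (S : SplitSeq F a b)
      {B₁ B₂ : Set Pt} {K₁ K₂ : PLMan n} {u₂ : F.C n K₂} (hK₁ : K₁.IsBall) (hK₂ : K₂.IsBall)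
      (h₁ : IsPart K₁ M), S.image K₁.carrier = B₁ → S.Occurs B₂ K₂ u₂ → B₁ ⊂ B₂ →
      U.Mem hK₁ (a.val K₁ h₁) → U.Mem hK₂ u₂ := by
    intro M X a b S B₁ B₂ K₁ K₂ u₂ hK₁ hK₂ h₁ hB₁ h₂ hlt hu
    obtain ⟨P, hP, t, -, rfl, ht⟩ := h₂.exists_part hK₂.nonempty
    subst hB₁
    have hsub := h₁.subset_of_meets hK₁.preconnected hP (S.meets h₁ hK₁.nonempty hlt.1)
    obtain ⟨Q, hQ, hQM⟩ := h₁.diff hP hsub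
    rw [a.mul h₁ hQM hP hQ] at ht
    exact U.ideal hK₂ hK₁ hQ t _ _ ⟨_, rfl⟩ _ ⟨u₂, rfl⟩ hu ht
  induction S with
  | nil c =>
    rintro B₁ B₂ K₁ K₂ u₁ u₂ hK₁ hK₂ ⟨h₁, rfl, rfl⟩ h₂ hlt hu
    refine main (.nil c) hK₁ hK₂ h₁ ?_ h₂ hlt hu
    ext p
    constructor
    · rintro ⟨x, hx, rfl⟩
      exact hx
    · exact fun hp => ⟨⟨p, h₁.subset hp⟩, hp, rfl⟩
  | cons g h S ih =>
    rintro B₁ B₂ K₁ K₂ u₁ u₂ hK₁ hK₂ h₁ h₂ hlt hu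
    rcases h₁ with ⟨h₁, rfl, rfl⟩ | h₁
    · exact main (.cons g h S) hK₁ hK₂ h₁ rfl h₂ hlt hu
    · rcases h₂ with ⟨h₂, rfl, rfl⟩ | h₂
      · exfalso
        have h₁' : (SplitSeq.cons g h S).Occurs B₁ K₁ u₁ := Or.inr h₁
        obtain ⟨P, hP, -, hne, rfl, -⟩ := h₁'.exists_part hK₁.nonempty
        have hm := (SplitSeq.cons g h S).meets hP hne hlt.1
        rw [Set.inter_comm] at hm
        have hsub := h₂.subset_of_meets hK₂.preconnected hP hm
        exact hlt.2 fun p ⟨x, hx, hp⟩ => ⟨x, hsub hx, hp⟩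
      · exact ih hK₁ hK₂ h₁ h₂ hlt hu

end SplitSeq

section

variable {F : FieldSystem.{u, v} R n} (U : LocalRelations F)

theorem IsBlobDiagram.comp_perm {X : PLMan n} {k : ℕ} {B : Fin k → Set Pt} {r : F.C n X}
    (h : IsBlobDiagram U B r) (σ : Equiv.Perm (Fin k)) : IsBlobDiagram U (B ∘ σ) r := by
  obtain ⟨M, a, b, hX, S, hr, hB⟩ := h
  refine ⟨M, a, b, hX, S, hr, fun i => ?_⟩
  obtain ⟨K, hK, u, ho, hu⟩ := hB (σ i)
  exact ⟨K, hK, u, ho, fun ht => hu fun j => by simpa using ht (σ.symm j)⟩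

theorem IsBlobDiagram.face {X : PLMan n} {k : ℕ} {B : Fin (k + 1) → Set Pt} {r : F.C n X}
    (h : IsBlobDiagram U B r) (i : Fin (k + 1)) : IsBlobDiagram U (B ∘ i.succAbove) r := by
  obtain ⟨M, a, b, hX, S, hr, hB⟩ := h
  refine ⟨M, a, b, hX, S, hr, fun j => ?_⟩
  obtain ⟨K, hK, u, ho, hu⟩ := hB (i.succAbove j)
  refine ⟨K, hK, u, ho, fun ht => ?_⟩
  by_cases hlt : B i ⊂ B (i.succAbove j)
  · obtain ⟨K', hK', u', ho', hu'⟩ := hB i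
    refine ho'.mem_of_ssubset U hK' hK ho hlt (hu' fun l hl => ?_)
    rcases Fin.eq_self_or_eq_succAbove i l with rfl | ⟨l, rfl⟩
    · exact hl.2 subset_rfl
    · exact ht l (hl.trans hlt)
  · refine hu fun l hl => ?_
    rcases Fin.eq_self_or_eq_succAbove i l with rfl | ⟨l, rfl⟩
    · exact hlt hl
    · exact ht l hl

end

/-! ### The blob complex -/
/-- Submodules of `L` of allowed labels, for all ordered configurations of blobs, stable under
forgetting a blob and under permuting the blobs. -/
structure ConfigLabels (S : Type) (R : Type u) [CommRing R] (L : Type v)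
    [AddCommGroup L] [Module R L] where
  D : {k : ℕ} → (Fin k → S) → Submodule R L
  face : ∀ {k : ℕ} (B : Fin (k + 1) → S) (i : Fin (k + 1)), D B ≤ D (B ∘ i.succAbove)
  perm : ∀ {k : ℕ} (B : Fin k → S) (σ : Equiv.Perm (Fin k)), D B ≤ D (B ∘ σ)

namespace ConfigLabels

variable {S : Type} {R : Type u} [CommRing R] {L : Type v} [AddCommGroup L] [Module R L]
  (T : ConfigLabels S R L)

/-- The direct sum over all ordered configurations of `k` blobs. -/
abbrev Ord (k : ℕ) : Type v := DirectSum (Fin k → S) fun B => T.D B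

open scoped Classical in
/-- The summand of a configuration. -/
def inj {k : ℕ} (B : Fin k → S) : T.D B →ₗ[R] T.Ord k :=
  DirectSum.lof R (Fin k → S) (fun B => T.D B) B

/-- Configurations differing by a permutation are identified up to its sign. -/
def rel (k : ℕ) : Submodule R (T.Ord k) :=
  Submodule.span R {z | ∃ (B : Fin k → S) (σ : Equiv.Perm (Fin k)) (r : T.D B),
    z = T.inj (B ∘ σ) ⟨r.1, T.perm B σ r.2⟩ - ((Equiv.Perm.sign σ : ℤ) • T.inj B r)}

/-- The space of `k`-chains. -/
abbrev Chain (k : ℕ) : Type v := T.Ord k ⧸ T.rel k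

/-- The chain given by a labelled configuration. -/
def chain {k : ℕ} (B : Fin k → S) : T.D B →ₗ[R] T.Chain k := (T.rel k).mkQ ∘ₗ T.inj B

open scoped Classical in
/-- The signed sum of the ways of forgetting one blob. -/
def dOrd (k : ℕ) : T.Ord (k + 1) →ₗ[R] T.Ord k :=
  DirectSum.toModule R (Fin (k + 1) → S) (T.Ord k) fun B =>
    ∑ i : Fin (k + 1), (-1 : ℤ) ^ (i : ℕ) •
      (T.inj (B ∘ i.succAbove) ∘ₗ Submodule.inclusion (T.face B i))

theorem inj_congr {k : ℕ} {B B' : Fin k → S} (h : B = B') (r : T.D B) (r' : T.D B')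
    (hr : r.1 = r'.1) : T.inj B r = T.inj B' r' := by
  subst h
  exact congrArg _ (Subtype.ext hr)

theorem dOrd_inj {k : ℕ} (B : Fin (k + 1) → S) (r : T.D B) :
    T.dOrd k (T.inj B r) = ∑ i : Fin (k + 1), (-1 : ℤ) ^ (i : ℕ) •
      T.inj (B ∘ i.succAbove) ⟨r.1, T.face B i r.2⟩ := by
  classical
  simp only [dOrd, inj, DirectSum.toModule_lof, LinearMap.sum_apply, LinearMap.smul_apply]
  rfl

theorem exists_perm_succAbove {k : ℕ} (σ : Equiv.Perm (Fin (k + 1))) (i : Fin (k + 1)) :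
    ∃ τ : Equiv.Perm (Fin k), (∀ j, σ (i.succAbove j) = (σ i).succAbove (τ j)) ∧
      (Equiv.Perm.sign τ : ℤ) * (-1) ^ (i : ℕ) = Equiv.Perm.sign σ * (-1) ^ (σ i : ℕ) := by
  set ρ : Equiv.Perm (Fin (k + 1)) := (σ i).cycleRange * σ * i.cycleRange⁻¹ with hρ
  have h0 : ρ 0 = 0 := by
    simp [hρ, Equiv.Perm.inv_def, Fin.cycleRange_symm_zero]
  obtain ⟨⟨p, τ⟩, hτ⟩ := Equiv.Perm.decomposeFin.symm.surjective ρ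
  have hp : p = 0 := by
    rw [← hτ] at h0
    simpa using h0
  subst hp
  refine ⟨τ, fun j => ?_, ?_⟩
  · have h1 : ρ j.succ = (τ j).succ := by rw [← hτ]; simp
    have h2 : (σ i).cycleRange (σ (i.succAbove j)) = (τ j).succ := by
      rw [← h1, hρ]
      simp [Equiv.Perm.inv_def, Fin.cycleRange_symm_succ]
    rw [← Fin.cycleRange_symm_succ (σ i), ← h2, Equiv.symm_apply_apply]
  · have h3 : Equiv.Perm.sign ρ = Equiv.Perm.sign τ := by
      rw [← hτ, Equiv.Perm.decomposeFin.symm_sign]; simp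
    rw [← h3, hρ]
    simp only [Equiv.Perm.sign_mul, Equiv.Perm.sign_inv, Fin.sign_cycleRange]
    push_cast
    have : ((-1 : ℤ) ^ (i : ℕ)) * (-1) ^ (i : ℕ) = 1 := by
      rw [← mul_pow]; simp
    linear_combination ((-1 : ℤ) ^ (σ i : ℕ) * Equiv.Perm.sign σ) * this

theorem rel_le_comap (k : ℕ) : T.rel (k + 1) ≤ (T.rel k).comap (T.dOrd k) := by
  refine Submodule.span_le.2 ?_
  rintro _ ⟨B, σ, r, rfl⟩
  simp only [Submodule.comap_coe, Set.mem_preimage, map_sub, map_zsmul, dOrd_inj, SetLike.mem_coe]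
  choose τ hτ hs using exists_perm_succAbove σ
  rw [← Equiv.sum_comp σ (fun i : Fin (k + 1) => (-1 : ℤ) ^ (i : ℕ) •
    T.inj (B ∘ i.succAbove) ⟨r.1, T.face B i r.2⟩), Finset.smul_sum, ← Finset.sum_sub_distrib]
  refine Submodule.sum_mem _ fun i _ => ?_
  have e : T.inj ((B ∘ σ) ∘ i.succAbove) ⟨r.1, T.face _ i (T.perm B σ r.2)⟩ =
      T.inj ((B ∘ (σ i).succAbove) ∘ τ i) ⟨r.1, T.perm _ (τ i) (T.face B (σ i) r.2)⟩ := by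
    refine T.inj_congr ?_ _ _ rfl
    funext j
    simp [hτ]
  rw [e, smul_smul, ← hs, mul_comm, mul_smul]
  have hz := zsmul_mem (Submodule.subset_span (R := R) ⟨_, τ i, ⟨r.1, T.face B (σ i) r.2⟩, rfl⟩ :
    _ ∈ T.rel k) ((-1 : ℤ) ^ (i : ℕ))
  rwa [zsmul_sub] at hz

/-- The differential. -/
def d (k : ℕ) : T.Chain (k + 1) →ₗ[R] T.Chain k :=
  Submodule.mapQ (T.rel (k + 1)) (T.rel k) (T.dOrd k) (T.rel_le_comap k)

theorem dOrd_dOrd (k : ℕ) (z : T.Ord (k + 2)) : T.dOrd k (T.dOrd (k + 1) z) = 0 := by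
  classical
  suffices h : T.dOrd k ∘ₗ T.dOrd (k + 1) = 0 from LinearMap.congr_fun h z
  refine DirectSum.linearMap_ext R fun B => LinearMap.ext fun r => ?_
  change T.dOrd k (T.dOrd (k + 1) (T.inj B r)) = 0
  simp only [dOrd_inj, map_sum, map_zsmul, Finset.smul_sum, smul_smul]
  rw [← Fintype.sum_prod_type' (f := fun (i : Fin (k + 2)) (j : Fin (k + 1)) =>
    ((-1 : ℤ) ^ (i : ℕ) * (-1) ^ (j : ℕ)) • T.inj ((B ∘ i.succAbove) ∘ j.succAbove)
      ⟨r.1, T.face _ j (T.face B i r.2)⟩)]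
  refine Finset.sum_involution (fun p _ => (p.1.succAbove p.2, p.2.predAbove p.1)) ?_ ?_ ?_ ?_
  · rintro ⟨i, j⟩ -
    have e : T.inj ((B ∘ i.succAbove) ∘ j.succAbove) ⟨r.1, T.face _ j (T.face B i r.2)⟩ =
        T.inj ((B ∘ (i.succAbove j).succAbove) ∘ (j.predAbove i).succAbove)
          ⟨r.1, T.face _ _ (T.face B _ r.2)⟩ := by
      refine T.inj_congr ?_ _ _ rfl
      funext l
      simp [Fin.succAbove_succAbove_succAbove_predAbove]
    simp only
    rw [e, ← pow_add, ← pow_add, Fin.neg_one_pow_succAbove_add_predAbove, neg_smul,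
      add_neg_cancel]
  · rintro ⟨i, j⟩ - - h
    exact Fin.succAbove_ne i j (congrArg Prod.fst h)
  · intro _ _
    exact Finset.mem_univ _
  · rintro ⟨i, j⟩ -
    simp only [Prod.mk.injEq]
    refine ⟨Fin.succAbove_succAbove_predAbove i j, ?_⟩
    exact Fin.predAbove_predAbove_succAbove i j

theorem d_comp_d (k : ℕ) : T.d k ∘ₗ T.d (k + 1) = 0 := by
  refine LinearMap.ext fun z => ?_
  obtain ⟨z, rfl⟩ := Submodule.Quotient.mk_surjective _ z
  change Submodule.Quotient.mk (T.dOrd k (T.dOrd (k + 1) z)) = 0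
  rw [dOrd_dOrd, Submodule.Quotient.mk_zero]

/-- The chain complex. -/
def complex : ChainComplex (ModuleCat.{v} R) ℕ :=
  ChainComplex.of (fun k => ModuleCat.of R (T.Chain k)) (fun k => ModuleCat.ofHom (T.d k))
    (fun k => by rw [← ModuleCat.ofHom_comp, d_comp_d]; rfl)

end ConfigLabels


/-- The modules of blob diagrams on `X` with boundary condition `c`, for all configurations. -/
def blobLabels {F : FieldSystem.{u, v} R n} (U : LocalRelations F) (X : PLMan n)
    (c : F.BC n X) : ConfigLabels (Set Pt) R (F.Fib n X c) where
  D := diagrams U X c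
  face _ i := Submodule.span_mono fun _ h => IsBlobDiagram.face U h i
  perm _ σ := Submodule.span_mono fun _ h => IsBlobDiagram.comp_perm U h σ

/-- The blob complex `B_*(X; c)`. -/
def blobComplex {F : FieldSystem.{u, v} R n} (U : LocalRelations F) (X : PLMan n)
    (c : F.BC n X) : ChainComplex (ModuleCat.{v} R) ℕ := (blobLabels U X c).complex

/-- The `k`-chain `(B, r)`. -/
def blobChain {F : FieldSystem.{u, v} R n} (U : LocalRelations F) {X : PLMan n}
    {c : F.BC n X} {k : ℕ} (B : Fin k → Set Pt) :
    diagrams U X c B →ₗ[R] (blobComplex U X c).X k := (blobLabels U X c).chain B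

open CategoryTheory

/-- The quotient map from the `0`-chains to the homology in degree zero. -/
def quotH0 (K : ChainComplex (ModuleCat.{v} R) ℕ) : K.X 0 ⟶ K.homology 0 :=
  K.pOpcycles 0 ≫ K.isoHomologyι₀.inv

/-- The natural chain map from a complex to its homology in degree zero. -/
def projH0 (K : ChainComplex (ModuleCat.{v} R) ℕ) :
    K ⟶ (ChainComplex.single₀ (ModuleCat.{v} R)).obj (K.homology 0) :=
  (ChainComplex.toSingle₀Equiv K _).symm
    ⟨quotH0 K, by rw [quotH0, HomologicalComplex.d_pOpcycles_assoc, Limits.zero_comp]⟩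

/-- A map from the homology in degree zero to the `0`-chains, as a chain map. -/
def inclH0 (K : ChainComplex (ModuleCat.{v} R) ℕ) (s : K.homology 0 ⟶ K.X 0) :
    (ChainComplex.single₀ (ModuleCat.{v} R)).obj (K.homology 0) ⟶ K :=
  (ChainComplex.fromSingle₀Equiv K _).symm s

end

end BlobComplex

open BlobComplex CategoryTheory

/-! Adding the whole ball as an outermost blob is a cone construction, and its apex is always
available on a ball. Any diagram there with at least one blob has a minimal blob, labelled by a
local relation. The field on the ball is glued from that label and a field on the rest, so by the
ideal property it is a local relation itself (`IsBlobDiagram.mem`). The ball can therefore be added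
without changing the label (`IsBlobDiagram.snoc`).

With the ball in the last place, forgetting an older blob commutes with adding the ball, and
forgetting the ball returns the original diagram; the sign in the homotopy makes the other terms
cancel (`d_cone_add_cone_d`). Only degree zero is an obstacle, since the label of a diagram without
blobs need not be a local relation. But the boundaries in degree zero are exactly the local
relations on the ball, and `x - s(p(x))` has class zero, so it may label the ball. This correction
leaves boundaries unchanged, which gives the homotopy identity in degree one as well
(`d_cone_add_coneZero_d`).

The same description of the boundaries identifies the homology in degree zero with the skein module:
every field on a ball is a `0`-blob diagram, and the skein relations on a ball are its local
relations. Over a field every module is projective, which provides the splitting.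

The algebra is carried out for any `ConfigLabels` with an element satisfying `IsApex`. Geometry
enters only to show that the ball is such an element, and to compute the labels allowed for no blob
and for the ball alone. -/

namespace BlobComplex

noncomputable section

/-! ### Chains of labelled configurations. -/

namespace ConfigLabels

variable {S : Type} {R : Type u} [CommRing R] {L : Type v} [AddCommGroup L] [Module R L]
  (T : ConfigLabels S R L)

theorem chain_congr {k : ℕ} {B B' : Fin k → S} (h : B = B') (r : T.D B) (r' : T.D B')
    (hr : r.1 = r'.1) : T.chain B r = T.chain B' r' :=
  congrArg (T.rel k).mkQ (T.inj_congr h r r' hr)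

theorem chain_perm {k : ℕ} (B : Fin k → S) (σ : Equiv.Perm (Fin k)) (r : T.D B) :
    T.chain (B ∘ σ) ⟨r.1, T.perm B σ r.2⟩ = (Equiv.Perm.sign σ : ℤ) • T.chain B r := by
  rw [← sub_eq_zero]
  change (T.rel k).mkQ _ - _ • (T.rel k).mkQ _ = 0
  rw [← map_zsmul, ← map_sub, Submodule.mkQ_apply, Submodule.Quotient.mk_eq_zero]
  exact Submodule.subset_span ⟨B, σ, r, rfl⟩

theorem d_chain {k : ℕ} (B : Fin (k + 1) → S) (r : T.D B) :
    T.d k (T.chain B r) = ∑ i : Fin (k + 1), (-1 : ℤ) ^ (i : ℕ) •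
      T.chain (B ∘ i.succAbove) ⟨r.1, T.face B i r.2⟩ := by
  change (T.rel k).mkQ (T.dOrd k (T.inj B r)) = _
  rw [dOrd_inj, map_sum]
  simp only [map_zsmul]
  rfl

theorem d_chain_zero (B : Fin 1 → S) (r : T.D B) :
    T.d 0 (T.chain B r) = T.chain ![] ⟨r.1, by
      rw [Subsingleton.elim ![] (B ∘ (0 : Fin 1).succAbove)]; exact T.face B 0 r.2⟩ := by
  rw [d_chain, Fin.sum_univ_one, Fin.val_zero, pow_zero, one_smul]
  exact T.chain_congr (Subsingleton.elim _ _) _ _ rfl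

/-- Linear maps on chains are determined by their values on configurations. -/
theorem chain_hom_ext {k : ℕ} {N : Type*} [AddCommGroup N] [Module R N] {f g : T.Chain k →ₗ[R] N}
    (h : ∀ (B : Fin k → S) (r : T.D B), f (T.chain B r) = g (T.chain B r)) : f = g := by
  classical
  refine Submodule.linearMap_qext _ (DirectSum.linearMap_ext R fun B => LinearMap.ext fun r => ?_)
  exact h B r

open scoped Classical in
/-- A linear map on chains given by its values on configurations. -/
def lift {k : ℕ} {N : Type v} [AddCommGroup N] [Module R N] (f : ∀ B : Fin k → S, T.D B →ₗ[R] N)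
    (hf : ∀ (B : Fin k → S) (σ : Equiv.Perm (Fin k)) (r : T.D B),
      f (B ∘ σ) ⟨r.1, T.perm B σ r.2⟩ = (Equiv.Perm.sign σ : ℤ) • f B r) : T.Chain k →ₗ[R] N :=
  (T.rel k).liftQ (DirectSum.toModule R (Fin k → S) N f) <| by
    refine Submodule.span_le.2 ?_
    rintro _ ⟨B, σ, r, rfl⟩
    simp only [SetLike.mem_coe, LinearMap.mem_ker, map_sub, map_zsmul, inj,
      DirectSum.toModule_lof, hf, sub_self]

theorem lift_chain {k : ℕ} {N : Type v} [AddCommGroup N] [Module R N]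
    (f : ∀ B : Fin k → S, T.D B →ₗ[R] N) (hf) (B : Fin k → S) (r : T.D B) :
    T.lift f hf (T.chain B r) = f B r := by
  classical
  change DirectSum.toModule R (Fin k → S) N f (DirectSum.lof R _ _ B r) = _
  rw [DirectSum.toModule_lof]

/-- The label of a chain of degree zero. -/
def label : T.Chain 0 →ₗ[R] L :=
  T.lift (fun B => (T.D B).subtype) fun B σ r => by
    -- The only permutation of no blobs is the identity, so the sign relation is void in degree
    -- zero.
    simp [Subsingleton.elim σ 1]

theorem label_chain (B : Fin 0 → S) (r : T.D B) : T.label (T.chain B r) = r.1 :=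
  T.lift_chain _ _ B r

/-- There is only one configuration of no blobs, so the direct sum has a single summand. -/
theorem exists_chain_eq (z : T.Chain 0) : ∃ r : T.D ![], T.chain ![] r = z := by
  suffices h : LinearMap.range (T.chain (![] : Fin 0 → S)) = ⊤ from LinearMap.range_eq_top.1 h z
  rw [← Submodule.ker_mkQ (LinearMap.range (T.chain (![] : Fin 0 → S))), LinearMap.ker_eq_top]
  refine T.chain_hom_ext fun B r => ?_
  obtain rfl := Subsingleton.elim B ![]
  simp

/-- Degree-zero chains become a submodule of `L`, so equalities between them and kernels on them can
be computed on labels. -/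
theorem label_injective : Function.Injective T.label := by
  intro z z' h
  obtain ⟨r, rfl⟩ := T.exists_chain_eq z
  obtain ⟨r', rfl⟩ := T.exists_chain_eq z'
  rw [label_chain, label_chain] at h
  rw [Subtype.ext h]

/-- Adding `x` to any configuration of positive degree keeps the allowed labels. -/
abbrev IsApex (x : S) : Prop :=
  ∀ ⦃k : ℕ⦄ (B : Fin (k + 1) → S), T.D B ≤ T.D (Fin.snoc B x : Fin (k + 2) → S)

/-! ### The cone over an apex. -/

section Cone

variable (x : S)

/-- Add `x` to the single blob, then forget the original one. -/
theorem D_le_singleton (hx : T.IsApex x) (B : Fin 1 → S) : T.D B ≤ T.D ![x] := by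
  have e : (Fin.snoc B x : Fin 2 → S) ∘ (0 : Fin 2).succAbove = ![x] := by
    funext i
    obtain rfl := Subsingleton.elim i 0
    rfl
  rw [← e]
  exact (hx B).trans (T.face _ 0)

/-- Among single blobs, `x` admits the most labels, so it alone accounts for all boundaries. This
serves both to define the homotopy in degree zero and to compute the homology there. -/
theorem map_label_range_d (hx : T.IsApex x) : (LinearMap.range (T.d 0)).map T.label = T.D ![x] := by
  refine le_antisymm ?_ fun r hr => ⟨_, ⟨T.chain ![x] ⟨r, hr⟩, rfl⟩, ?_⟩
  -- The inclusion is recast as the vanishing of a linear map on `T.Chain 1`, which can be tested on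
  -- single configurations.
  · rw [Submodule.map_le_iff_le_comap, LinearMap.range_le_iff_comap, ← Submodule.comap_comp,
      ← Submodule.ker_mkQ (T.D ![x]), ← LinearMap.ker_comp, LinearMap.ker_eq_top]
    refine T.chain_hom_ext fun B r => ?_
    rw [LinearMap.comp_apply, LinearMap.comp_apply, d_chain_zero,
      label_chain, LinearMap.zero_apply, Submodule.mkQ_apply, Submodule.Quotient.mk_eq_zero]
    exact T.D_le_singleton x hx B r.2
  · rw [d_chain_zero, label_chain]

/-- Needed for the cone to respect the identification of reordered configurations. -/
theorem exists_perm_snoc {k : ℕ} (σ : Equiv.Perm (Fin k)) : ∃ τ : Equiv.Perm (Fin (k + 1)),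
    Equiv.Perm.sign τ = Equiv.Perm.sign σ ∧
      ∀ B : Fin k → S, (Fin.snoc (B ∘ σ) x : Fin (k + 1) → S) =
        (Fin.snoc B x : Fin (k + 1) → S) ∘ τ := by
  -- The extension of `σ` fixing the last index: `optionCongr` fixes `none`, which
  -- `finSuccEquivLast` matches with that index.
  refine ⟨finSuccEquivLast.symm.permCongr σ.optionCongr, ?_, fun B => ?_⟩
  · rw [Equiv.Perm.sign_permCongr, Equiv.optionCongr_sign]
  · funext i
    refine Fin.lastCases ?_ (fun j => ?_) i <;> simp [Equiv.permCongr_apply]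

/-- Adding `x` as the last member of a configuration of positive degree, with a sign. -/
def cone (hx : T.IsApex x) (k : ℕ) : T.Chain (k + 1) →ₗ[R] T.Chain (k + 2) :=
  T.lift (fun B => (-1 : ℤ) ^ (k + 1) • (T.chain (Fin.snoc B x) ∘ₗ Submodule.inclusion (hx B)))
    fun B σ r => by
      obtain ⟨τ, hs, hτ⟩ := exists_perm_snoc x σ
      simp only [LinearMap.smul_apply, LinearMap.comp_apply]
      rw [smul_comm, ← hs, ← T.chain_perm]
      exact congrArg _ (T.chain_congr (hτ B) _ _ rfl)

theorem cone_chain (hx : T.IsApex x) (k : ℕ) (B : Fin (k + 1) → S) (r : T.D B) :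
    T.cone x hx k (T.chain B r) =
      (-1 : ℤ) ^ (k + 1) • T.chain (Fin.snoc B x) ⟨r.1, hx B r.2⟩ :=
  T.lift_chain _ _ B r

theorem snoc_comp_castSucc_succAbove {k : ℕ} (B : Fin (k + 1) → S) (i : Fin (k + 1)) :
    (Fin.snoc B x : Fin (k + 2) → S) ∘ i.castSucc.succAbove =
      (Fin.snoc (B ∘ i.succAbove) x : Fin (k + 1) → S) := by
  funext j
  refine Fin.lastCases ?_ (fun j => ?_) j
  · simp
  · simp

theorem snoc_comp_last_succAbove {k : ℕ} (B : Fin k → S) :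
    (Fin.snoc B x : Fin (k + 1) → S) ∘ (Fin.last k).succAbove = B := by
  funext j
  simp

/-- Since `x` comes last, the older blobs keep their indices and signs, and forgetting `x` carries
the sign of the last index. -/
theorem d_chain_snoc (hx : T.IsApex x) {k : ℕ} (B : Fin (k + 1) → S) (r : L) (h : r ∈ T.D B) :
    T.d (k + 1) (T.chain (Fin.snoc B x) ⟨r, hx B h⟩) =
      (∑ i : Fin (k + 1), (-1 : ℤ) ^ (i : ℕ) •
        T.chain (Fin.snoc (B ∘ i.succAbove) x)
          ⟨r, snoc_comp_castSucc_succAbove x B i ▸ T.face _ _ (hx B h)⟩) +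
      (-1 : ℤ) ^ (k + 1) • T.chain B ⟨r, h⟩ := by
  rw [d_chain, Fin.sum_univ_castSucc]
  congr 1
  · refine Finset.sum_congr rfl fun i _ => ?_
    rw [Fin.val_castSucc]
    exact congrArg _ (T.chain_congr (snoc_comp_castSucc_succAbove x B i) _ _ rfl)
  · rw [Fin.val_last]
    exact congrArg _ (T.chain_congr (snoc_comp_last_succAbove x B) _ _ rfl)

/-- The sign in `cone` is the one with which `d` forgets `x`, so that face contributes the identity.
The faces that keep `x` occur in both composites with opposite signs, because the cone sign changes
with the degree. -/
theorem d_cone_add_cone_d (hx : T.IsApex x) (k : ℕ) :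
    T.d (k + 2) ∘ₗ T.cone x hx (k + 1) + T.cone x hx k ∘ₗ T.d (k + 1) = LinearMap.id := by
  refine T.chain_hom_ext fun B r => ?_
  simp only [LinearMap.add_apply, LinearMap.comp_apply, LinearMap.id_apply, cone_chain, map_zsmul,
    d_chain_snoc]
  rw [d_chain, map_sum]
  simp only [map_zsmul, cone_chain]
  rw [smul_add, smul_smul, ← mul_pow, neg_one_mul, neg_neg, one_pow, one_smul, Finset.smul_sum,
    add_right_comm, ← Finset.sum_add_distrib, Finset.sum_eq_zero, zero_add]
  intro i _
  rw [smul_smul, smul_smul, ← add_smul, pow_succ]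
  -- The two coefficients of each face differ by one factor `-1`.
  convert zero_smul ℤ _ using 2
  ring

variable {x}

/-- The degree zero part of the contraction: an endomorphism of the `0`-chains with labels in the
labels of `x`, followed by adding `x`. -/
def coneZero (f : T.Chain 0 →ₗ[R] T.Chain 0) (hf : ∀ z, T.label (f z) ∈ T.D ![x]) :
    T.Chain 0 →ₗ[R] T.Chain 1 :=
  T.chain ![x] ∘ₗ (T.label ∘ₗ f).codRestrict (T.D ![x]) hf

theorem d_coneZero (f : T.Chain 0 →ₗ[R] T.Chain 0) (hf : ∀ z, T.label (f z) ∈ T.D ![x])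
    (z : T.Chain 0) : T.d 0 (T.coneZero f hf z) = f z := by
  apply T.label_injective
  change T.label (T.d 0 (T.chain ![x] _)) = _
  rw [d_chain_zero, label_chain]
  rfl

/-- For a single blob `B` with label `r`, the boundary of the cone is `(B; r) - (x; r)`. The term to
be cancelled is supplied by `coneZero`, because `f` does not change the boundary `r`. -/
theorem d_cone_add_coneZero_d (hx : T.IsApex x) (f : T.Chain 0 →ₗ[R] T.Chain 0)
    (hf : ∀ z, T.label (f z) ∈ T.D ![x]) (hfd : ∀ z, f (T.d 0 z) = T.d 0 z) :
    T.d 1 ∘ₗ T.cone x hx 0 + T.coneZero f hf ∘ₗ T.d 0 = LinearMap.id := by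
  refine T.chain_hom_ext fun B r => ?_
  have e : T.coneZero f hf (T.d 0 (T.chain B r)) =
      T.chain ![x] ⟨r.1, T.D_le_singleton x hx B r.2⟩ := by
    refine congrArg (T.chain ![x]) (Subtype.ext ?_)
    change T.label (f (T.d 0 (T.chain B r))) = r.1
    rw [hfd, d_chain_zero, label_chain]
  have e' (i : Fin 1) : T.chain (Fin.snoc (B ∘ i.succAbove) x)
      ⟨r.1, snoc_comp_castSucc_succAbove x B i ▸ T.face _ _ (hx B r.2)⟩ =
      T.chain ![x] ⟨r.1, T.D_le_singleton x hx B r.2⟩ := by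
    refine T.chain_congr ?_ _ _ rfl
    funext j
    exact Fin.cases rfl (fun j => j.elim0) j
  simp only [LinearMap.add_apply, LinearMap.comp_apply, LinearMap.id_apply, cone_chain, map_zsmul,
    d_chain_snoc, e, e']
  simp

end Cone

end ConfigLabels

/-! ### Local relations spread from a blob to the whole ball. -/

open PLMan

variable {R : Type u} [CommRing R] {n : ℕ}

namespace SplitSeq

variable {F : FieldSystem.{u, v} R n}

/-- The whole manifold is the last stage of a gluing decomposition. -/
theorem occurs_last {M X : PLMan n} {a : SplitField F M} {b : SplitField F X}
    (S : SplitSeq F a b) : S.Occurs X.carrier X (b.val X (IsPart.refl X)) := by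
  induction S with
  | nil a => exact ⟨IsPart.refl _, rfl, rfl⟩
  | cons g h S ih => exact Or.inr ih

theorem image_subset {M X : PLMan n} {a : SplitField F M} {b : SplitField F X}
    (S : SplitSeq F a b) (K : Set Pt) : S.image K ⊆ X.carrier := by
  rintro _ ⟨x, -, rfl⟩
  exact (S.map x).2

theorem Occurs.subset {M X : PLMan n} {a : SplitField F M} {b : SplitField F X}
    {S : SplitSeq F a b} {B : Set Pt} {K : PLMan n} {u : F.C n K} (h : S.Occurs B K u) :
    B ⊆ X.carrier := by
  induction S with
  | nil a =>
    obtain ⟨hK, -, rfl⟩ := h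
    exact hK.subset
  | cons g h' S ih =>
    rcases h with ⟨hK, -, rfl⟩ | h
    · exact image_subset _ _
    · exact ih h

/-- If the restriction to some component is a local relation, then so is the field on the whole
ball. -/
theorem Occurs.mem_last (U : LocalRelations F) {M X : PLMan n} {a : SplitField F M}
    {b : SplitField F X} {S : SplitSeq F a b} {B : Set Pt} {K : PLMan n} {u : F.C n K}
    (hK : K.IsBall) (hX : X.IsBall) (h : S.Occurs B K u) (hu : U.Mem hK u) :
    U.Mem hX (b.val X (IsPart.refl X)) := by
  -- The case of a component `K` of the first manifold. The ball `X` is glued from a part `P` of `M`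
  -- whose image is all of `X`, so generic points of `K` force `K` to meet `P`, and connectedness
  -- puts `K` inside `P`. The field on `X` is thus glued from `u` and a field on the rest of `P`.
  -- Unlike in `Occurs.mem_of_ssubset`, the image of `K` may be all of `X`.
  have main : ∀ {M X : PLMan n} {a : SplitField F M} {b : SplitField F X} (S : SplitSeq F a b)
      (hX : X.IsBall) (h : IsPart K M), U.Mem hK (a.val K h) →
      U.Mem hX (b.val X (IsPart.refl X)) := by
    intro M X a b S hX h hu
    obtain ⟨P, hP, t, -, hPX, ht⟩ := S.occurs_last.exists_part hX.nonempty
    have hsub := h.subset_of_meets hK.preconnected hP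
      (S.meets h hK.nonempty (hPX ▸ image_subset S _))
    obtain ⟨Q, hQ, hQM⟩ := h.diff hP hsub
    rw [a.mul h hQM hP hQ] at ht
    exact U.ideal hX hK hQ t _ _ ⟨_, rfl⟩ _ ⟨_, rfl⟩ hu ht
  induction S with
  | nil a =>
    obtain ⟨hK', rfl, -⟩ := h
    exact main (.nil a) hX hK' hu
  | cons g h' S ih =>
    rcases h with ⟨hK', rfl, -⟩ | h
    · exact main (.cons g h' S) hX hK' hu
    -- Dropping the first gluing leaves a shorter decomposition in which `K` still occurs.
    · exact ih hX h

end SplitSeq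

section

variable {F : FieldSystem.{u, v} R n} (U : LocalRelations F)

/-- A finite nonempty family of sets has a minimal member; this is why the cone needs positive
degree. -/
theorem exists_isTwig {k : ℕ} (B : Fin (k + 1) → Set Pt) : ∃ i, IsTwig B i := by
  obtain ⟨i, -, hi⟩ := Set.finite_univ.exists_minimalFor B Set.univ Set.univ_nonempty
  exact ⟨i, fun j hj => hj.2 (hi (Set.mem_univ j) hj.1)⟩

/-- A field on a ball occurring in a blob diagram with at least one blob is a local relation. -/
theorem IsBlobDiagram.mem {X : PLMan n} (hX : X.IsBall) {k : ℕ} {B : Fin (k + 1) → Set Pt}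
    {r : F.C n X} (h : IsBlobDiagram U B r) : U.Mem hX r := by
  obtain ⟨M, a, b, -, S, rfl, hB⟩ := h
  obtain ⟨i, hi⟩ := exists_isTwig B
  obtain ⟨K, hK, u, ho, hu⟩ := hB i
  exact ho.mem_last U hK hX (hu hi)

/-- The whole ball can be added to a blob diagram with at least one blob. -/
theorem IsBlobDiagram.snoc {X : PLMan n} (hX : X.IsBall) {k : ℕ} {B : Fin (k + 1) → Set Pt}
    {r : F.C n X} (h : IsBlobDiagram U B r) :
    IsBlobDiagram U (Fin.snoc B X.carrier : Fin (k + 2) → Set Pt) r := by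
  have hr := h.mem U hX
  obtain ⟨M, a, b, hXX, S, rfl, hB⟩ := h
  refine ⟨M, a, b, hXX, S, rfl, fun i => ?_⟩
  -- The added ball is itself a twig if all older blobs equal it, so its label must be a local
  -- relation; `hr` covers every case.
  refine Fin.lastCases ⟨X, hX, _, ?_, fun _ => hr⟩ (fun i => ?_) i
  · rw [Fin.snoc_last]
    exact S.occurs_last
  · obtain ⟨K, hK, u, ho, hu⟩ := hB i
    -- An older blob that is a twig in the larger configuration was already one in the smaller.
    refine ⟨K, hK, u, by rwa [Fin.snoc_castSucc], fun ht => hu fun j hj => ht j.castSucc ?_⟩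
    rwa [Fin.snoc_castSucc, Fin.snoc_castSucc]

end

/-! ### The undivided ball: its fields, local relations and skein relations. -/

theorem PLMan.IsPart.eq_or_empty {K P : PLMan n} (hK : _root_.IsPreconnected K.carrier)
    (h : IsPart P K) : P = K ∨ P.carrier = ∅ := by
  rcases P.carrier.eq_empty_or_nonempty with he | ⟨x, hx⟩
  · exact Or.inr he
  · exact Or.inl (PLMan.ext (h.subset.antisymm
      ((IsPart.refl K).subset_of_meets hK h ⟨x, h.subset hx, hx⟩)))

/-- There is an empty manifold, complementary to a given one. -/
theorem PLMan.exists_isDisjUnion_empty (X : PLMan n) :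
    ∃ E : PLMan n, E.carrier = ∅ ∧ IsDisjUnion X X E := by
  obtain ⟨E, hE⟩ := IsPart.refl X
  refine ⟨E, Set.eq_empty_of_forall_notMem fun x hx => ?_, hE⟩
  exact Set.disjoint_left.1 hE.1 (hE.2 ▸ Or.inr hx) hx

open scoped Classical in
/-- A field on a ball, as a split field. -/
def SplitField.ofBall (F : FieldSystem.{u, v} R n) {X : PLMan n} (hX : X.IsBall) (r : F.C n X) :
    SplitField F X where
  -- By connectedness the only parts are `X` and the empty manifold, so the product condition
  -- reduces to the unit laws of disjoint union.
  val P hP := if h : X = P then h ▸ r else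
    F.empty ((hP.eq_or_empty hX.preconnected).resolve_left (Ne.symm h))
  mul {P Q T} hP hQ hT h := by
    have hne {E : PLMan n} (hE : E.carrier = ∅) : X ≠ E := by
      rintro rfl
      exact hX.nonempty.ne_empty hE
    rcases hP.eq_or_empty hX.preconnected with rfl | hP0 <;>
    rcases hQ.eq_or_empty hX.preconnected with rfl | hQ0
    · exact absurd (disjoint_self.1 h.1) hX.nonempty.ne_empty
    · obtain rfl : T = P := PLMan.ext (by rw [h.2, hQ0, Set.union_empty])
      rw [dif_pos rfl, dif_neg (hne hQ0), F.du_empty h hQ0 _ le_rfl]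
    · obtain rfl : T = Q := PLMan.ext (by rw [h.2, hP0, Set.empty_union])
      rw [dif_pos rfl, dif_neg (hne hP0), F.du_comm h h.symm _ _ le_rfl,
        F.du_empty h.symm hP0 _ le_rfl]
    -- Here all three manifolds are empty, and the unit law is applied to the empty field itself.
    · obtain rfl : T = P := PLMan.ext (by rw [h.2, hQ0, Set.union_empty])
      rw [dif_neg (hne hP0), dif_neg (hne hQ0), F.du_empty h hQ0 _ le_rfl]

theorem SplitField.ofBall_val (F : FieldSystem.{u, v} R n) {X : PLMan n} (hX : X.IsBall)
    (r : F.C n X) (h : IsPart X X) : (SplitField.ofBall F hX r).val X h = r :=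
  dif_pos rfl

section

variable {F : FieldSystem.{u, v} R n} (U : LocalRelations F) {X : PLMan n} (c : F.BC n X)

theorem LocalRelations.mem_iff (hX : X.IsBall) (r : F.Fib n X c) : U.Mem hX r.1 ↔ r ∈ U.U X hX c := by
  obtain ⟨r, rfl⟩ := r
  rfl

/-- The decomposition without any gluing suffices, as every field on a ball is a split field. -/
theorem diagrams_zero (hX : X.IsBall) (B : Fin 0 → Set Pt) : diagrams U X c B = ⊤ :=
  eq_top_iff.2 fun r _ => Submodule.subset_span ⟨X, .ofBall F hX r.1, .ofBall F hX r.1,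
    IsPart.refl X, .nil _, SplitField.ofBall_val F hX r.1 _, fun i => i.elim0⟩

/-- A blob diagram with a blob has a local relation as its field; conversely, the undivided ball
serves as its own blob. -/
theorem diagrams_singleton (hX : X.IsBall) : diagrams U X c ![X.carrier] = U.U X hX c := by
  refine le_antisymm (Submodule.span_le.2 fun r hr => (U.mem_iff c hX r).1 (hr.mem U hX))
    fun r hr => Submodule.subset_span ⟨X, .ofBall F hX r.1, .ofBall F hX r.1,
      IsPart.refl X, .nil _, SplitField.ofBall_val F hX r.1 _, fun i => ⟨X, hX, r.1, ?_, ?_⟩⟩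
  · refine ⟨IsPart.refl X, (SplitField.ofBall_val F hX r.1 _).symm, ?_⟩
    rw [Subsingleton.elim i 0]
    rfl
  · exact fun _ => (U.mem_iff c hX r).2 hr

/-- The ideal property absorbs relations on smaller balls; conversely, the embedded ball may be `X`
with empty complement. -/
theorem LocalRelations.skeinRel_eq (hX : X.IsBall) : U.skeinRel X c = U.U X hX c := by
  refine le_antisymm (Submodule.span_le.2 ?_) fun r hr => Submodule.subset_span ?_
  · rintro x ⟨B, E, D, hB, h, s, u, r, -, -, hu, hx⟩
    exact U.ideal hX hB h s c _ ⟨u, rfl⟩ r x hu hx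
  · obtain ⟨E, hE, h⟩ := X.exists_isDisjUnion_empty
    have hinj (s : Set X.carrier) : Set.InjOn (GlueSeq.iso (PLEquiv.refl X)).map s :=
      Function.Injective.injOn fun _ _ h => h
    refine ⟨X, E, X, hX, h, .iso (PLEquiv.refl X), r.1, F.empty hE, hinj _, hinj _,
      (U.mem_iff c hX r).2 hr, ?_⟩
    rw [F.du_empty h hE _ le_rfl]
    exact SplitSeq.seqGlues_refl X r.1

theorem isApex_blobLabels (hX : X.IsBall) : (blobLabels U X c).IsApex X.carrier :=
  fun _ _ => Submodule.span_mono fun _ h => IsBlobDiagram.snoc U hX h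

end

/-! ### Homology in degree zero and its chain maps. -/

section

variable (K : ChainComplex (ModuleCat.{v} R) ℕ)

instance epi_quotH0 : Epi (quotH0 K) := by
  unfold quotH0
  infer_instance

/-- Up to `isoHomologyι₀`, the map is the projection to the opcycles, a cokernel of `K.d 1 0`, and
its kernel is the range by exactness. -/
theorem quotH0_eq_zero_iff (z : K.X 0) : quotH0 K z = 0 ↔ ∃ y : K.X 1, K.d 1 0 y = z := by
  have hw : K.d 1 0 ≫ quotH0 K = 0 := by
    rw [quotH0, HomologicalComplex.d_pOpcycles_assoc, Limits.zero_comp]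
  let S : ShortComplex (ModuleCat.{v} R) := ShortComplex.mk (K.d 1 0) (K.pOpcycles 0) (by simp)
  have hS : S.Exact := S.exact_of_g_is_cokernel (K.opcyclesIsCokernel 1 0 (by simp))
  constructor
  · intro h
    refine (ShortComplex.moduleCat_exact_iff S).1 hS z ?_
    have h' : K.isoHomologyι₀.hom (quotH0 K z) = K.pOpcycles 0 z := by
      change (quotH0 K ≫ K.isoHomologyι₀.hom) z = _
      rw [quotH0, Category.assoc, Iso.inv_hom_id, Category.comp_id]
    rw [h, map_zero] at h'
    exact h'.symm
  · rintro ⟨y, rfl⟩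
    change (K.d 1 0 ≫ quotH0 K) y = 0
    rw [hw]
    rfl

theorem projH0_f_zero : (projH0 K).f 0 = quotH0 K :=
  ChainComplex.toSingle₀Equiv_symm_apply_f_zero _ _

theorem inclH0_f_zero (s : K.homology 0 ⟶ K.X 0) : (inclH0 K s).f 0 = s :=
  ChainComplex.fromSingle₀Equiv_symm_apply_f_zero s

theorem inclH0_f_succ (s : K.homology 0 ⟶ K.X 0) (k : ℕ) : (inclH0 K s).f (k + 1) = 0 :=
  rfl

theorem inclH0_comp_projH0 (s : K.homology 0 ⟶ K.X 0) (hs : s ≫ quotH0 K = 𝟙 _) :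
    inclH0 K s ≫ projH0 K = 𝟙 _ := by
  apply (ChainComplex.fromSingle₀Equiv _ _).injective
  change (inclH0 K s).f 0 ≫ (projH0 K).f 0 = 𝟙 _
  rw [projH0_f_zero, inclH0_f_zero]
  exact hs

theorem projH0_comp_inclH0_f_zero (s : K.homology 0 ⟶ K.X 0) :
    (projH0 K ≫ inclH0 K s).f 0 = quotH0 K ≫ s := by
  change (projH0 K).f 0 ≫ (inclH0 K s).f 0 = _
  rw [projH0_f_zero, inclH0_f_zero]
  rfl

theorem projH0_comp_inclH0_f_succ (s : K.homology 0 ⟶ K.X 0) (k : ℕ) :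
    (projH0 K ≫ inclH0 K s).f (k + 1) = 0 := by
  rw [HomologicalComplex.comp_f, inclH0_f_succ, Limits.comp_zero]

end

/-! ### The contracting homotopy, the homology and the splitting. -/

namespace ConfigLabels

variable {S : Type} {L : Type v} [AddCommGroup L] [Module R L] (T : ConfigLabels S R L)

theorem complex_d (k : ℕ) : T.complex.d (k + 1) k = ModuleCat.ofHom (T.d k) := by
  change ChainComplex.of.d (fun k => ModuleCat.of R (T.Chain k))
    (fun k => ModuleCat.ofHom (T.d k)) (k + 1) k = _
  exact ChainComplex.of_d _ _ _

theorem quotH0_eq_zero_iff (z : T.complex.X 0) :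
    quotH0 T.complex z = 0 ↔ z ∈ LinearMap.range (T.d 0) := by
  rw [BlobComplex.quotH0_eq_zero_iff, complex_d]
  rfl

variable {x : S} (hx : T.IsApex x) (s : T.complex.homology 0 ⟶ T.complex.X 0)
  (hs : s ≫ quotH0 T.complex = 𝟙 _)

/-- The difference of the identity and the idempotent given by a splitting. -/
def defect : T.Chain 0 →ₗ[R] T.Chain 0 := LinearMap.id - (quotH0 T.complex ≫ s).hom

theorem defect_d (z : T.complex.X 1) : T.defect s (T.d 0 z) = T.d 0 z := by
  have h : quotH0 T.complex (T.d 0 z) = 0 := (T.quotH0_eq_zero_iff _).2 ⟨z, rfl⟩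
  change (show T.complex.X 0 from T.d 0 z) - s (quotH0 T.complex (T.d 0 z)) = _
  rw [h, map_zero, sub_zero]

/-- Because `s` splits the quotient map, the defect has class zero; it is then a boundary, and
labels of boundaries are allowed for `x`. -/
theorem label_defect_mem (hx : T.IsApex x) (hs : s ≫ quotH0 T.complex = 𝟙 _) (z : T.complex.X 0) :
    T.label (T.defect s z) ∈ T.D ![x] := by
  rw [← T.map_label_range_d x hx]
  refine Submodule.mem_map_of_mem ((T.quotH0_eq_zero_iff _).1 ?_)
  change quotH0 T.complex (z - s (quotH0 T.complex z)) = 0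
  rw [map_sub, sub_eq_zero]
  exact (congrArg (fun f => f (quotH0 T.complex z)) hs).symm

/-- The contraction in all degrees. -/
def coneHom : ∀ k, T.complex.X k ⟶ T.complex.X (k + 1)
  | 0 => ModuleCat.ofHom (T.coneZero (T.defect s) (T.label_defect_mem s hx hs))
  | k + 1 => ModuleCat.ofHom (T.cone x hx k)

/-- The contraction, as a homotopy. -/
def coneHomotopy : Homotopy (𝟙 T.complex) (projH0 T.complex ≫ inclH0 T.complex s) where
  -- A homotopy is indexed by all pairs of degrees; the transport is trivial when `j` is literally
  -- `i + 1`.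
  hom i j := if h : i + 1 = j then T.coneHom hx s hs i ≫ eqToHom (congrArg T.complex.X h) else 0
  zero i j h := dif_neg h
  comm i := by
    -- The exceptional map `coneZero` occurs alone in degree zero, together with `cone` in degree
    -- one, and not at all above.
    match i with
    | 0 =>
      rw [Homotopy.dNext_zero_chainComplex, Homotopy.prevD_chainComplex, zero_add, dif_pos rfl,
        projH0_comp_inclH0_f_zero, eqToHom_refl, Category.comp_id, complex_d, ← sub_eq_iff_eq_add]
      refine ModuleCat.hom_ext (LinearMap.ext fun z => ?_)
      exact (T.d_coneZero (T.defect s) (T.label_defect_mem s hx hs) z).symm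
    | 1 =>
      rw [Homotopy.dNext_succ_chainComplex, Homotopy.prevD_chainComplex, dif_pos rfl, dif_pos rfl,
        projH0_comp_inclH0_f_succ, eqToHom_refl, eqToHom_refl, Category.comp_id, Category.comp_id,
        complex_d, complex_d, add_zero, add_comm]
      exact ModuleCat.hom_ext (T.d_cone_add_coneZero_d hx (T.defect s)
        (T.label_defect_mem s hx hs) (T.defect_d s)).symm
    | k + 2 =>
      rw [Homotopy.dNext_succ_chainComplex, Homotopy.prevD_chainComplex, dif_pos rfl, dif_pos rfl,
        projH0_comp_inclH0_f_succ, eqToHom_refl, eqToHom_refl, Category.comp_id, Category.comp_id,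
        complex_d, complex_d, add_zero]
      refine Eq.trans ?_ (add_comm _ _)
      exact ModuleCat.hom_ext (T.d_cone_add_cone_d x hx k).symm

theorem coneHomotopy_hom (k : ℕ) :
    (T.coneHomotopy hx s hs).hom k (k + 1) = T.coneHom hx s hs k := by
  simp [coneHomotopy]

theorem coneHomotopy_hom_zero (r r' : T.D ![])
    (hr : T.chain ![] r' = s (quotH0 T.complex (T.chain ![] r))) :
    ∃ h : r.1 - r'.1 ∈ T.D ![x], (T.coneHomotopy hx s hs).hom 0 1 (T.chain ![] r) =
      T.chain ![x] ⟨r.1 - r'.1, h⟩ := by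
  have e : T.label (T.defect s (T.chain ![] r)) = r.1 - r'.1 := by
    change T.label ((show T.complex.X 0 from T.chain ![] r) -
      s (quotH0 T.complex (T.chain ![] r))) = _
    rw [← hr, ← T.label_chain ![] r, ← T.label_chain ![] r']
    exact map_sub T.label _ _
  refine ⟨e ▸ T.label_defect_mem s hx hs (T.chain ![] r), ?_⟩
  rw [T.coneHomotopy_hom hx s hs 0]
  exact congrArg (T.chain ![x]) (Subtype.ext e)

theorem quotH0_surjective : Function.Surjective (quotH0 T.complex) :=
  (ModuleCat.epi_iff_surjective _).1 inferInstance

/-- If every label is allowed for the empty configuration, the homology in degree zero is the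
quotient by the labels of an apex. -/
theorem exists_homology_equiv (hx : T.IsApex x) (htop : T.D ![] = ⊤) (W : Submodule R L)
    (hW : T.D ![x] = W) : ∃ φ : T.complex.homology 0 ≃ₗ[R] L ⧸ W, ∀ r : L, ∃ h : r ∈ T.D ![],
      φ (quotH0 T.complex (T.chain ![] ⟨r, h⟩)) = W.mkQ r := by
  have hmem (r : L) : r ∈ T.D ![] := htop ▸ Submodule.mem_top
  let p : T.Chain 0 →ₗ[R] T.complex.homology 0 := (quotH0 T.complex).hom
  have hp : Function.Surjective p := T.quotH0_surjective
  let ψ : T.Chain 0 →ₗ[R] L ⧸ W := W.mkQ ∘ₗ T.label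
  have hψ : Function.Surjective ψ := W.mkQ_surjective.comp fun r =>
    ⟨T.chain ![] ⟨r, hmem r⟩, T.label_chain _ _⟩
  -- Two surjections from the `0`-chains with the same kernel have isomorphic targets; both kernels
  -- are the boundaries, since `label` is injective.
  have hker : LinearMap.ker p = LinearMap.ker ψ := by
    rw [LinearMap.ker_comp, Submodule.ker_mkQ, ← hW, ← T.map_label_range_d x hx,
      Submodule.comap_map_eq_of_injective T.label_injective]
    exact Submodule.ext T.quotH0_eq_zero_iff
  let e := p.quotKerEquivOfSurjective hp
  refine ⟨e.symm ≪≫ₗ Submodule.quotEquivOfEq _ _ hker ≪≫ₗ ψ.quotKerEquivOfSurjective hψ,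
    fun r => ⟨hmem r, ?_⟩⟩
  change ψ.quotKerEquivOfSurjective hψ (Submodule.quotEquivOfEq _ _ hker
    (e.symm (p (T.chain ![] _)))) = _
  rw [show e.symm (p (T.chain ![] ⟨r, hmem r⟩)) = Submodule.Quotient.mk _ from
    e.symm_apply_eq.2 rfl]
  exact congrArg W.mkQ (T.label_chain _ _)

theorem exists_splitting (hR : IsField R) :
    ∃ s : T.complex.homology 0 ⟶ T.complex.X 0, s ≫ quotH0 T.complex = 𝟙 _ := by
  let := hR.toField
  -- The homology is projective over a field, so its identity lifts through the surjection.
  obtain ⟨f, hf⟩ := Module.projective_lifting_property (quotH0 T.complex).hom LinearMap.id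
    T.quotH0_surjective
  exact ⟨ModuleCat.ofHom f, ModuleCat.hom_ext hf⟩

end ConfigLabels

end

end BlobComplex

theorem proposition3p2p1 {R : Type u} [CommRing R] {n : ℕ} (F : FieldSystem.{u, v} R n)
    (U : LocalRelations F) (X : PLMan n) (hX : X.IsBall) (c : F.BC n X) :
    (∀ s : (blobComplex U X c).homology 0 ⟶ (blobComplex U X c).X 0,
      s ≫ quotH0 (blobComplex U X c) = 𝟙 _ →
      (∃ e : HomotopyEquiv (blobComplex U X c)
          ((ChainComplex.single₀ (ModuleCat.{v} R)).obj ((blobComplex U X c).homology 0)),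
        e.hom = projH0 (blobComplex U X c) ∧ e.inv = inclH0 (blobComplex U X c) s) ∧
      ∃ H : Homotopy (𝟙 (blobComplex U X c))
          (projH0 (blobComplex U X c) ≫ inclH0 (blobComplex U X c) s),
        (∀ x y : diagrams U X c ![],
          blobChain U ![] y = s (quotH0 (blobComplex U X c) (blobChain U ![] x)) →
          ∃ h : x.1 - y.1 ∈ diagrams U X c ![X.carrier],
            H.hom 0 1 (blobChain U ![] x) = blobChain U ![X.carrier] ⟨x.1 - y.1, h⟩) ∧
        ∀ (k : ℕ) (B : Fin (k + 1) → Set Pt) (r : diagrams U X c B),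
          ∃ h : r.1 ∈ diagrams U X c (Fin.snoc B X.carrier : Fin (k + 2) → Set Pt),
            H.hom (k + 1) (k + 2) (blobChain U B r) =
              (-1 : ℤ) ^ (k + 1) • blobChain U (Fin.snoc B X.carrier) ⟨r.1, h⟩) ∧
    (IsField R → ∃ s : (blobComplex U X c).homology 0 ⟶ (blobComplex U X c).X 0,
      s ≫ quotH0 (blobComplex U X c) = 𝟙 _) ∧
    ∃ φ : (blobComplex U X c).homology 0 ≃ₗ[R] U.Skein X c, ∀ x : F.Fib n X c,
      ∃ h : x ∈ diagrams U X c ![],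
        φ (quotH0 (blobComplex U X c) (blobChain U ![] ⟨x, h⟩)) = (U.skeinRel X c).mkQ x := by
  have hx := isApex_blobLabels U c hX
  -- A homotopy equivalence asks for a homotopy from the composite to the identity, the reverse of
  -- `coneHomotopy`; the other composite equals the identity exactly.
  refine ⟨fun s hs => ⟨⟨⟨projH0 _, inclH0 _ s, ((blobLabels U X c).coneHomotopy hx s hs).symm,
    Homotopy.ofEq (inclH0_comp_projH0 _ s hs)⟩, rfl, rfl⟩,
    (blobLabels U X c).coneHomotopy hx s hs,
    (blobLabels U X c).coneHomotopy_hom_zero hx s hs, fun k B r => ⟨hx B r.2, ?_⟩⟩,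
    (blobLabels U X c).exists_splitting,
    (blobLabels U X c).exists_homology_equiv hx (diagrams_zero U c hX _) _
      ((diagrams_singleton U c hX).trans (U.skeinRel_eq c hX).symm)⟩
  exact (congrArg (fun f => f (blobChain U B r))
    ((blobLabels U X c).coneHomotopy_hom hx s hs (k + 1))).trans
    ((blobLabels U X c).cone_chain X.carrier hx k B r)
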